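/- Let $\mathbb D$ be the open unit disc, $H(\mathbb D)$ the analytic functions on $\mathbb D$, and $dm=\frac1\pi dx\,dy$. For an arc $I\subset\partial\mathbb D$ (of positive length) let $|I|$ be its normalized length, so that $|\partial\mathbb D|=1$, and let $S(I)=\{z\in\mathbb D: 1-|I|\le |z|<1,\ z/|z|\in I\}$ be its Carleson box, with $S(\partial\mathbb D)=\mathbb D$. For $0<\lambda<1$, the analytic Morrey space $\mathcal L^{2,\lambda}$ consists of all $f$ in the Hardy space $H^2$ whose radial boundary function satisfies $$\sup_{I\subset\partial\mathbb D}\Big(\frac1{|I|^\lambda}\int_I|f(\zeta)-f_I|^2\frac{|d\zeta|}{2\pi}\Big)^{1/2}<\infty,\qquad f_I=\frac1{|I|}\int_I f(\zeta)\frac{|d\zeta|}{2\pi},$$ and it is normed by $$\|f\|_{\mathcal L^{2,\lambda}}=|f(0)|+\sup_{I\subset\partial\mathbb D}\Big(\frac1{|I|^\lambda}\int_{S(I)}|f'(z)|^2(1-|z|^2)\,dm(z)\Big)^{1/2}.$$ The Bloch space $B$ consists of all $f\in H(\mathbb D)$ with $|f(0)|+\sup_{z\in\mathbb D}(1-|z|^2)|f'(z)|<\infty$,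 this quantity being its norm. For $\alpha>-1$, $H^\infty_\alpha$ consists of all $g\in H(\mathbb D)$ with $\|g\|_\alpha=\sup_{z\in\mathbb D}(1-|z|^2)^\alpha|g(z)|<\infty$. For $g,f\in H(\mathbb D)$ put $I_gf(z)=\int_0^z f'(w)g(w)\,dw$. **Theorem.** Let $0<\lambda<1$. For every $g\in H(\mathbb D)$, the operator $I_g:\mathcal L^{2,\lambda}\to B$ is bounded if and only if $g\in H^\infty_{(\lambda-1)/2}$. Moreover, there are constants $c,C\in(0,\infty)$ depending only on $\lambda$ such that, for every $g\in H(\mathbb D)$, $$c\,\|g\|_{\frac{\lambda-1}2}\le\|I_g\|_{\mathcal L^{2,\lambda}\to B}\le C\,\|g\|_{\frac{\lambda-1}2},$$ where $\|I_g\|_{\mathcal L^{2,\lambda}\to B}$ is the least constant $K\in[0,\infty]$ with $\|I_gf\|_B\le K\|f\|_{\mathcal L^{2,\lambda}}$ for all $f\in\mathcal L^{2,\lambda}$. -/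

import Mathlib

open MeasureTheory Filter Topology Set
open scoped ENNReal NNReal

noncomputable section

namespace MorreyBloch

/-- The open unit disc. -/
def disc : Set ℂ := Metric.ball 0 1

/-- `f ∈ H(𝔻)`. A function on the disc is represented by a function on `ℂ`; its values outside
the disc play no role in any of the definitions below. -/
def Holo (f : ℂ → ℂ) : Prop := DifferentiableOn ℂ f disc

/-- The normalized area measure `dm = π⁻¹ dx dy`. -/
def area : Measure ℂ := ENNReal.ofReal (1 / Real.pi) • volume

/-- The pairs `(a, b)` describing the arcs `{e^{iθ} : a ≤ θ ≤ b}` of the unit circle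
(of positive length, the full circle being included). -/
def IsArc (a b : ℝ) : Prop := a < b ∧ b ≤ a + 2 * Real.pi

/-- The normalized length `|I|` of the arc `I = {e^{iθ} : a ≤ θ ≤ b}`. -/
def arcLength (a b : ℝ) : ℝ := (b - a) / (2 * Real.pi)

/-- The Carleson box `S(I)` based on the arc `I = {e^{iθ} : a ≤ θ ≤ b}`. For the full circle
it is the whole disc, the origin included. -/
def carlesonBox (a b : ℝ) : Set ℂ :=
  {z | 1 - arcLength a b ≤ ‖z‖ ∧ ‖z‖ < 1 ∧ ∃ θ ∈ Icc a b, z = ‖z‖ * Complex.exp (θ * Complex.I)}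

/-- `f` belongs to the Hardy space `H²`. -/
def MemHardy (f : ℂ → ℂ) : Prop :=
  Holo f ∧
    (⨆ r ∈ Ioo (0 : ℝ) 1, ENNReal.ofReal (1 / (2 * Real.pi)) *
      ∫⁻ θ in Icc 0 (2 * Real.pi), ‖f (r * Complex.exp (θ * Complex.I))‖ₑ ^ 2) < ∞

/-- `F` is the boundary function of `f`: the radial limit of `f` at almost every point of the
unit circle. (Every `f ∈ H²` has one, unique up to null sets.) -/
def IsBoundaryFunction (f : ℂ → ℂ) (F : Circle → ℂ) : Prop :=
  ∀ᵐ θ : ℝ, Tendsto (fun r : ℝ => f (r * Complex.exp (θ * Complex.I))) (𝓝[<] 1)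
    (𝓝 (F (Circle.exp θ)))

/-- The average `F_I = |I|⁻¹ ∫_I F |dζ| / (2π)`. -/
def arcMean (F : Circle → ℂ) (a b : ℝ) : ℂ :=
  ((1 / arcLength a b * (1 / (2 * Real.pi)) : ℝ) : ℂ) * ∫ θ in Icc a b, F (Circle.exp θ)

/-- `sup_I (|I|^{-λ} ∫_I |F - F_I|² |dζ| / (2π))^{1/2}`. -/
def meanOscillation (lam : ℝ) (F : Circle → ℂ) : ℝ≥0∞ :=
  ⨆ (a : ℝ) (b : ℝ) (_ : IsArc a b),
    (ENNReal.ofReal (1 / arcLength a b ^ lam) * (ENNReal.ofReal (1 / (2 * Real.pi)) *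
      ∫⁻ θ in Icc a b, ‖F (Circle.exp θ) - arcMean F a b‖ₑ ^ 2)) ^ (1 / 2 : ℝ)

/-- `f` belongs to the analytic Morrey space `L^{2,λ}`. -/
def MemMorrey (lam : ℝ) (f : ℂ → ℂ) : Prop :=
  MemHardy f ∧ ∃ F : Circle → ℂ, IsBoundaryFunction f F ∧ meanOscillation lam F < ∞

/-- The norm of `L^{2,λ}`:
`|f(0)| + sup_I (|I|^{-λ} ∫_{S(I)} |f'(z)|² (1 - |z|²) dm(z))^{1/2}`. -/
def morreyNorm (lam : ℝ) (f : ℂ → ℂ) : ℝ≥0∞ :=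
  ‖f 0‖ₑ + ⨆ (a : ℝ) (b : ℝ) (_ : IsArc a b),
    (ENNReal.ofReal (1 / arcLength a b ^ lam) *
      ∫⁻ z in carlesonBox a b, ‖deriv f z‖ₑ ^ 2 * ENNReal.ofReal (1 - ‖z‖ ^ 2) ∂area) ^ (1 / 2 : ℝ)

/-- The Bloch norm `|f(0)| + sup_{z ∈ 𝔻} (1 - |z|²) |f'(z)|`. -/
def blochNorm (f : ℂ → ℂ) : ℝ≥0∞ :=
  ‖f 0‖ₑ + ⨆ z ∈ disc, ENNReal.ofReal ((1 - ‖z‖ ^ 2) * ‖deriv f z‖)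

/-- `f` belongs to the Bloch space `B`. -/
def MemBloch (f : ℂ → ℂ) : Prop := Holo f ∧ blochNorm f < ∞

/-- The weighted norm `‖g‖_α = sup_{z ∈ 𝔻} (1 - |z|²)^α |g(z)|`. -/
def weightedNorm (α : ℝ) (g : ℂ → ℂ) : ℝ≥0∞ :=
  ⨆ z ∈ disc, ENNReal.ofReal ((1 - ‖z‖ ^ 2) ^ α * ‖g z‖)

/-- `g` belongs to the weighted space `H^∞_α`. -/
def MemWeighted (α : ℝ) (g : ℂ → ℂ) : Prop := Holo g ∧ weightedNorm α g < ∞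

/-- `I_g f (z) = ∫_0^z f'(w) g(w) dw`, the integral being taken along the segment `[0, z]`. -/
def opI (g f : ℂ → ℂ) (z : ℂ) : ℂ :=
  ∫ t in (0 : ℝ)..1, deriv f (t * z) * g (t * z) * z

/-- `I_g` is a bounded operator from `L^{2,λ}` to `B`. -/
def IsBoundedI (lam : ℝ) (g : ℂ → ℂ) : Prop :=
  (∀ f, MemMorrey lam f → MemBloch (opI g f)) ∧
    ∃ C : ℝ≥0, ∀ f, MemMorrey lam f → blochNorm (opI g f) ≤ C * morreyNorm lam f

/-- The operator norm of `I_g : L^{2,λ} → B`, the least admissible constant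
(`∞` when there is no finite one). -/
def opNormI (lam : ℝ) (g : ℂ → ℂ) : ℝ≥0∞ :=
  sInf {C : ℝ≥0∞ | ∀ f, MemMorrey lam f → blochNorm (opI g f) ≤ C * morreyNorm lam f}

end MorreyBloch

end

/-!
Since `I_g f` is the primitive of `f' g`, its Bloch norm is `sup (1 - |z|²) |f'(z)| |g(z)|`. The
theorem therefore amounts to the fact that the norm of the functional `f ↦ f'(z)` on the Morrey
space is comparable to `(1 - |z|²)^{-(3-λ)/2}`, with constants which depend on neither `z` nor `f`.

* Upper bound (`norm_deriv_le_morreyNorm`): a disc centred at `z` with radius comparable to `1 - |z|`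
  lies in a Carleson box of comparable size, and `|f'|²` has the sub-mean value property.
* Lower bound (`morreyNorm_testFun_le`): the functions `(1 - |w|²)^{(λ+1)/2} z / (1 - w̄ z)` are
  bounded in the Morrey space uniformly in `w`, and their derivatives attain the bound at `w`. On
  boxes with `|I| ≤ 1 - |w|²` the integrand is estimated by its maximum, on larger boxes by its
  integral over the disc, which the Poisson kernel computes.

Membership in the Morrey space is defined by the mean oscillation of the boundary function, whereas
the norm is defined by Carleson boxes. The boundedness of `I_g` includes that `I_g f` is a Bloch
function for each `f` in the space, and for this a growth estimate for `f'` is derived directly from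
the mean oscillation (`MemMorrey.exists_norm_deriv_le`): Cauchy's formula expresses `f'(z)` through
the boundary function, and the integral is summed over dyadic arcs centred at `z / |z|`.

The exponent `(λ - 1) / 2` is negative, so by the maximum principle only `g = 0` has finite weighted
norm. The estimates hold for each pair `z`, `f` separately and do not rely on this.
-/

namespace MorreyBloch

/-! ### The derivative of `I_g f` -/

lemma mem_disc {z : ℂ} : z ∈ disc ↔ ‖z‖ < 1 := by simp [disc]

lemma isOpen_disc : IsOpen disc := Metric.isOpen_ball

lemma Holo.deriv {f : ℂ → ℂ} (hf : Holo f) : Holo (deriv f) :=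
  DifferentiableOn.deriv hf isOpen_disc

lemma opI_zero (g f : ℂ → ℂ) : opI g f 0 = 0 := by simp [opI]

/-- `I_g f` is the primitive of `f' g` which vanishes at the origin. -/
lemma hasDerivAt_opI {g f : ℂ → ℂ} (hg : Holo g) (hf : Holo f) {z : ℂ} (hz : z ∈ disc) :
    HasDerivAt (opI g f) (deriv f z * g z) z := by
  have hfg : DifferentiableOn ℂ (fun w => deriv f w * g w) disc := hf.deriv.mul hg
  obtain ⟨P, hP⟩ := DifferentiableOn.isExactOn_ball hfg
  have key : ∀ w ∈ disc, opI g f w = P w - P 0 := by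
    intro w hw
    have hseg : ∀ t ∈ uIcc (0 : ℝ) 1, (t * w : ℂ) ∈ disc := by
      intro t ht
      rw [uIcc_of_le zero_le_one] at ht
      rw [mem_disc] at hw ⊢
      rw [norm_mul, Complex.norm_real, Real.norm_of_nonneg ht.1]
      nlinarith [norm_nonneg w, ht.1, ht.2]
    have hline : ∀ t : ℝ, HasDerivAt (fun t : ℝ => (t * w : ℂ)) w t := fun t => by
      simpa using (Complex.ofRealCLM.hasDerivAt (x := t)).mul_const w
    have hd : ∀ t ∈ uIcc (0 : ℝ) 1,
        HasDerivAt (fun t : ℝ => P (t * w)) (deriv f (t * w) * g (t * w) * w) t := fun t ht =>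
      (hP _ (hseg t ht)).comp (𝕜 := ℝ) t (hline t)
    have hc : ContinuousOn (fun t : ℝ => deriv f (t * w) * g (t * w) * w) (uIcc 0 1) :=
      (hfg.continuousOn.comp (by fun_prop) hseg).mul continuousOn_const
    have := intervalIntegral.integral_eq_sub_of_hasDerivAt hd hc.intervalIntegrable
    simpa [opI] using this
  refine ((hP z hz).sub_const (P 0)).congr_of_eventuallyEq ?_
  filter_upwards [isOpen_disc.mem_nhds hz] with w hw using key w hw

lemma holo_opI {g f : ℂ → ℂ} (hg : Holo g) (hf : Holo f) : Holo (opI g f) := fun _ hz =>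
  (hasDerivAt_opI hg hf hz).differentiableAt.differentiableWithinAt

lemma blochNorm_opI {g f : ℂ → ℂ} (hg : Holo g) (hf : Holo f) :
    blochNorm (opI g f) = ⨆ z ∈ disc, ENNReal.ofReal ((1 - ‖z‖ ^ 2) * ‖deriv f z * g z‖) := by
  rw [blochNorm, opI_zero, enorm_zero, zero_add]
  exact iSup_congr fun z => iSup_congr fun hz => by rw [(hasDerivAt_opI hg hf hz).deriv]

/-! ### Integration in polar coordinates -/

/-- Integration in polar coordinates over a disc centred at `c`. -/
lemma lintegral_ball_eq_polar {φ : ℂ → ℝ≥0∞} (hφ : Measurable φ) (c : ℂ) (R : ℝ) :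
    ∫⁻ z in Metric.ball c R, φ z =
      ∫⁻ r in Ioo 0 R, ENNReal.ofReal r * ∫⁻ θ in Ioo (-Real.pi) Real.pi, φ (circleMap c r θ) := by
  have hm : Measurable ((Metric.ball c R).indicator φ) := hφ.indicator measurableSet_ball
  rw [← lintegral_indicator measurableSet_ball, ← lintegral_add_left_eq_self _ c,
    ← Complex.lintegral_comp_polarCoord_symm]
  have hsymm : ∀ p : ℝ × ℝ, c + Complex.polarCoord.symm p = circleMap c p.1 p.2 := fun p => by
    rw [Complex.polarCoord_symm_apply, circleMap, Complex.exp_mul_I, Complex.ofReal_cos,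
      Complex.ofReal_sin]
  simp only [hsymm, polarCoord_target, smul_eq_mul]
  rw [Measure.volume_eq_prod, ← Measure.prod_restrict, lintegral_prod]
  · have : Ioo (0 : ℝ) R = Ioi 0 ∩ Iio R := rfl
    rw [this, inter_comm, ← Measure.restrict_restrict measurableSet_Iio,
      ← lintegral_indicator measurableSet_Iio]
    refine setLIntegral_congr_fun measurableSet_Ioi fun r hr => ?_
    have hr' : (0 : ℝ) < r := hr
    have hmem : ∀ θ, circleMap c r θ ∈ Metric.ball c R ↔ r < R := fun θ => by
      rw [Metric.mem_ball, dist_eq_norm, circleMap_sub_center, norm_circleMap_zero, abs_of_pos hr']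
    have hcirc : Measurable fun θ => φ (circleMap c r θ) :=
      hφ.comp (continuous_circleMap c r).measurable
    by_cases h : r < R
    · simp [indicator, hmem, h, lintegral_const_mul _ hcirc]
    · simp [indicator, hmem, h]
  · refine ((measurable_fst.ennreal_ofReal).mul (hm.comp ?_)).aemeasurable
    unfold circleMap
    fun_prop

/-! ### The derivative is controlled by the Morrey norm -/

lemma circleAverage_eq_integral_Ioo {E : Type*} [NormedAddCommGroup E] [NormedSpace ℝ E]
    (h : ℂ → E) (c : ℂ) (r : ℝ) :
    Real.circleAverage h c r =
      (2 * Real.pi)⁻¹ • ∫ θ in Ioo (-Real.pi) Real.pi, h (circleMap c r θ) := by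
  have hpi := Real.pi_pos
  rw [Real.circleAverage_eq_integral_add (-Real.pi),
    intervalIntegral.integral_comp_add_right (fun θ => h (circleMap c r θ)),
    intervalIntegral.integral_of_le (by linarith), integral_Ioc_eq_integral_Ioo]
  ring_nf

/-- Sub-mean value property of `|h|²` over circles. -/
lemma sq_norm_le_lintegral_circle {h : ℂ → ℂ} {c : ℂ} {r : ℝ} (hr : 0 < r)
    (hh : DifferentiableOn ℂ h (Metric.closedBall c r)) :
    ENNReal.ofReal (2 * Real.pi * ‖h c‖ ^ 2) ≤
      ∫⁻ θ in Ioo (-Real.pi) Real.pi, ‖h (circleMap c r θ)‖ₑ ^ 2 := by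
  have hd : DiffContOnCl ℂ (fun z => h z ^ 2) (Metric.ball c |r|) := by
    rw [abs_of_pos hr]
    refine DifferentiableOn.diffContOnCl ?_
    rw [closure_ball c hr.ne']
    exact hh.pow 2
  have h1 : Real.circleAverage (fun z => h z ^ 2) c r = h c ^ 2 := hd.circleAverage
  rw [circleAverage_eq_integral_Ioo, inv_smul_eq_iff₀ (by positivity)] at h1
  calc ENNReal.ofReal (2 * Real.pi * ‖h c‖ ^ 2)
      = ‖∫ θ in Ioo (-Real.pi) Real.pi, h (circleMap c r θ) ^ 2‖ₑ := by
        rw [h1, ← ofReal_norm, norm_smul, norm_pow, Real.norm_of_nonneg (by positivity)]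
    _ ≤ ∫⁻ θ in Ioo (-Real.pi) Real.pi, ‖h (circleMap c r θ) ^ 2‖ₑ :=
        enorm_integral_le_lintegral_enorm _
    _ = _ := by simp only [enorm_pow]

/-- Sub-mean value property of `|h|²` over discs. -/
lemma sq_norm_le_lintegral_ball {h : ℂ → ℂ} (hm : Measurable h) {c : ℂ} {R : ℝ} (hR : 0 < R)
    (hh : DifferentiableOn ℂ h (Metric.ball c R)) :
    ENNReal.ofReal (Real.pi * R ^ 2 * ‖h c‖ ^ 2) ≤ ∫⁻ z in Metric.ball c R, ‖h z‖ₑ ^ 2 := by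
  rw [lintegral_ball_eq_polar (by fun_prop)]
  calc ENNReal.ofReal (Real.pi * R ^ 2 * ‖h c‖ ^ 2)
      = ENNReal.ofReal (∫ r in Ioo 0 R, r * (2 * Real.pi * ‖h c‖ ^ 2)) := by
        rw [← integral_Ioc_eq_integral_Ioo, ← intervalIntegral.integral_of_le hR.le,
          intervalIntegral.integral_mul_const, integral_id]
        ring_nf
    _ = ∫⁻ r in Ioo 0 R, ENNReal.ofReal (r * (2 * Real.pi * ‖h c‖ ^ 2)) := by
        refine ofReal_integral_eq_lintegral_ofReal ?_ ?_
        · exact (Continuous.integrableOn_Icc (by fun_prop)).mono_set Ioo_subset_Icc_self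
        · filter_upwards [ae_restrict_mem measurableSet_Ioo] with r hr
          have := hr.1.le
          positivity
    _ ≤ _ := by
        refine setLIntegral_mono' measurableSet_Ioo fun r hr => ?_
        rw [ENNReal.ofReal_mul hr.1.le]
        gcongr
        exact sq_norm_le_lintegral_circle hr.1
          (hh.mono (Metric.closedBall_subset_ball hr.2))

/-- A Whitney disc at `z` is contained in the Carleson box of the arc centred at `z / |z|` whose
length is comparable to `1 - |z|`. -/
lemma ball_subset_carlesonBox {z : ℂ} (hz : z ∈ disc) {h : ℝ} (hh : h = min 1 (2 * (1 - ‖z‖))) :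
    Metric.ball z ((1 - ‖z‖) / 4) ⊆ carlesonBox (z.arg - Real.pi * h) (z.arg + Real.pi * h) := by
  intro w hw
  rw [mem_disc] at hz
  rw [Metric.mem_ball, dist_eq_norm] at hw
  have hpi := Real.pi_gt_three
  have hlen : arcLength (z.arg - Real.pi * h) (z.arg + Real.pi * h) = h := by
    unfold arcLength; field_simp; ring
  have hwz : ‖w‖ ≤ ‖z‖ + ‖w - z‖ := by simpa using norm_add_le z (w - z)
  have hzw : ‖z‖ ≤ ‖w‖ + ‖w - z‖ := by
    rw [norm_sub_rev]; simpa using norm_add_le w (z - w)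
  refine ⟨?_, by linarith, ?_⟩
  · rw [hlen, hh]
    rcases min_cases 1 (2 * (1 - ‖z‖)) with ⟨h1, -⟩ | ⟨h1, -⟩ <;> rw [h1]
    · simp
    · linarith
  · rcases le_or_gt 1 (2 * (1 - ‖z‖)) with h1 | h1
    · -- the arc is the full circle
      rw [min_eq_left h1] at hh
      obtain ⟨θ, ⟨h1θ, h2θ⟩, hθ⟩ : ∃ θ ∈ Icc (z.arg - Real.pi) (z.arg + Real.pi),
          w = ‖w‖ * Complex.exp (θ * Complex.I) := by
        have h2 := toIocMod_mem_Ioc Real.two_pi_pos (z.arg - Real.pi) w.arg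
        refine ⟨toIocMod Real.two_pi_pos (z.arg - Real.pi) w.arg, ⟨h2.1.le, by linarith [h2.2]⟩, ?_⟩
        rw [toIocMod]
        conv_lhs => rw [← Complex.norm_mul_exp_arg_mul_I w]
        congr 1
        rw [Complex.exp_eq_exp_iff_exists_int]
        refine ⟨toIocDiv Real.two_pi_pos (z.arg - Real.pi) w.arg, ?_⟩
        push_cast [zsmul_eq_mul]
        ring
      exact ⟨θ, by simpa [hh] using And.intro h1θ h2θ, hθ⟩
    · rw [min_eq_right h1.le] at hh
      have hz0 : z ≠ 0 := by
        rintro rfl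
        norm_num at h1
      have hzp : 0 < ‖z‖ := norm_pos_iff.mpr hz0
      set e : ℂ := (w - z) / z with he
      have hwe : w = z * (1 + e) := by rw [he]; field_simp; ring
      have hen : ‖e‖ ≤ (1 - ‖z‖) / 2 := by
        rw [he, norm_div, div_le_iff₀ hzp]
        nlinarith
      have hlog := Complex.norm_log_one_add_half_le_self (z := e) (by linarith)
      have harg : |(1 + e).arg| ≤ 3 / 2 * ‖e‖ := by
        rw [← Complex.log_im]
        exact (Complex.abs_im_le_norm _).trans hlog
      rw [abs_le] at harg
      refine ⟨z.arg + (1 + e).arg, ⟨?_, ?_⟩, ?_⟩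
      · rw [hh]; nlinarith
      · rw [hh]; nlinarith
      · have h2 := Complex.norm_mul_exp_arg_mul_I z
        have h3 := Complex.norm_mul_exp_arg_mul_I (1 + e)
        push_cast
        rw [hwe, norm_mul, add_mul, Complex.exp_add]
        push_cast
        conv_lhs => rw [← h2, ← h3]
        ring

/-- The derivative of a function at `z` is controlled by its Morrey norm: this is the sub-mean value
property of `|f'|²` on a Whitney disc, which lies in a Carleson box of comparable size. -/
theorem norm_deriv_le_morreyNorm {lam : ℝ} (h0 : 0 < lam) (h1 : lam < 1) {f : ℂ → ℂ} (hf : Holo f)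
    {z : ℂ} (hz : z ∈ disc) :
    ENNReal.ofReal ((1 - ‖z‖ ^ 2) ^ ((3 - lam) / 2) * ‖deriv f z‖) ≤ 20 * morreyNorm lam f := by
  have hz1 : ‖z‖ < 1 := mem_disc.mp hz
  set ρ := 1 - ‖z‖ with hρ
  have hρ0 : 0 < ρ := by linarith
  have hρ1 : ρ ≤ 1 := by linarith [norm_nonneg z]
  set h := min 1 (2 * ρ) with hh
  have hhpos : 0 < h := lt_min one_pos (by linarith)
  have hh2 : h ≤ 2 * ρ := min_le_right _ _
  have hpi := Real.pi_pos
  have hlen : arcLength (z.arg - Real.pi * h) (z.arg + Real.pi * h) = h := by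
    unfold arcLength; field_simp; ring
  have harc : IsArc (z.arg - Real.pi * h) (z.arg + Real.pi * h) := by
    have : h ≤ 1 := min_le_left _ _
    constructor <;> nlinarith
  have hsub := ball_subset_carlesonBox hz hh
  have hball : Metric.ball z (ρ / 4) ⊆ disc := fun w hw => (mem_disc.mpr (hsub hw).2.1)
  have hbox : ENNReal.ofReal (3 * ρ ^ 3 / 64 * ‖deriv f z‖ ^ 2) ≤
      ∫⁻ w in carlesonBox (z.arg - Real.pi * h) (z.arg + Real.pi * h),
        ‖deriv f w‖ₑ ^ 2 * ENNReal.ofReal (1 - ‖w‖ ^ 2) ∂area := by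
    calc ENNReal.ofReal (3 * ρ ^ 3 / 64 * ‖deriv f z‖ ^ 2)
        = ENNReal.ofReal (1 / Real.pi) * (ENNReal.ofReal (Real.pi * (ρ / 4) ^ 2 * ‖deriv f z‖ ^ 2) *
            ENNReal.ofReal (3 * ρ / 4)) := by
          rw [← ENNReal.ofReal_mul (by positivity), ← ENNReal.ofReal_mul (by positivity)]
          congr 1
          field_simp
          ring
      _ ≤ ENNReal.ofReal (1 / Real.pi) * ((∫⁻ w in Metric.ball z (ρ / 4), ‖deriv f w‖ₑ ^ 2) *
            ENNReal.ofReal (3 * ρ / 4)) := by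
          gcongr
          exact sq_norm_le_lintegral_ball (measurable_deriv f) (by positivity)
            (hf.deriv.mono hball)
      _ = ENNReal.ofReal (1 / Real.pi) * ∫⁻ w in Metric.ball z (ρ / 4),
            ‖deriv f w‖ₑ ^ 2 * ENNReal.ofReal (3 * ρ / 4) := by
          have := measurable_deriv f
          rw [lintegral_mul_const _ (by fun_prop)]
      _ ≤ ENNReal.ofReal (1 / Real.pi) * ∫⁻ w in Metric.ball z (ρ / 4),
            ‖deriv f w‖ₑ ^ 2 * ENNReal.ofReal (1 - ‖w‖ ^ 2) := by
          gcongr 1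
          refine setLIntegral_mono' measurableSet_ball fun w hw => ?_
          gcongr
          rw [Metric.mem_ball, dist_eq_norm] at hw
          have hwz : ‖w‖ ≤ ‖z‖ + ‖w - z‖ := by simpa using norm_add_le z (w - z)
          nlinarith [norm_nonneg w]
      _ ≤ _ := by
          rw [area, Measure.restrict_smul, lintegral_smul_measure, smul_eq_mul]
          gcongr
  have hsup : (ENNReal.ofReal (1 / h ^ lam) * ENNReal.ofReal (3 * ρ ^ 3 / 64 * ‖deriv f z‖ ^ 2))
      ^ (1 / 2 : ℝ) ≤ morreyNorm lam f := by
    refine le_trans ?_ le_add_self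
    refine le_trans ?_ (le_iSup₂_of_le (z.arg - Real.pi * h) (z.arg + Real.pi * h)
      (le_iSup_of_le harc le_rfl))
    rw [hlen]
    gcongr
  refine le_trans ?_ (mul_le_mul_right hsup 20)
  rw [← ENNReal.ofReal_mul (by positivity), ENNReal.ofReal_rpow_of_nonneg (by positivity) (by norm_num),
    ← ENNReal.ofReal_ofNat, ← ENNReal.ofReal_mul (by norm_num)]
  apply ENNReal.ofReal_le_ofReal
  have hδ : 0 ≤ 1 - ‖z‖ ^ 2 := by nlinarith [norm_nonneg z]
  have hδ2 : 1 - ‖z‖ ^ 2 ≤ 2 * ρ := by nlinarith [norm_nonneg z]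
  rw [← Real.sqrt_eq_rpow]
  have hA : (1 - ‖z‖ ^ 2) ^ (3 - lam) * h ^ lam ≤ 8 * ρ ^ 3 := by
    calc (1 - ‖z‖ ^ 2) ^ (3 - lam) * h ^ lam ≤ (2 * ρ) ^ (3 - lam) * (2 * ρ) ^ lam := by
          gcongr
          linarith
      _ = 8 * ρ ^ 3 := by
          rw [← Real.rpow_add (by positivity)]
          norm_num
          ring
  refine le_of_sq_le_sq ?_ (by positivity)
  have hpow : ((1 - ‖z‖ ^ 2) ^ ((3 - lam) / 2)) ^ 2 = (1 - ‖z‖ ^ 2) ^ (3 - lam) := by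
    rw [← Real.rpow_mul_natCast hδ]
    norm_num
  have hhl : 0 < h ^ lam := Real.rpow_pos_of_pos hhpos _
  rw [mul_pow, mul_pow, hpow, Real.sq_sqrt (by positivity)]
  calc (1 - ‖z‖ ^ 2) ^ (3 - lam) * ‖deriv f z‖ ^ 2
      ≤ 8 * ρ ^ 3 / h ^ lam * ‖deriv f z‖ ^ 2 := by
        gcongr
        rwa [le_div_iff₀ hhl]
    -- `8 ≤ 20² · 3 / 64`, which is where the constant `20` comes from
    _ ≤ 20 ^ 2 * (3 * ρ ^ 3 / 64) / h ^ lam * ‖deriv f z‖ ^ 2 := by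
        gcongr ?_ / _ * _
        nlinarith [pow_pos hρ0 3]
    _ = _ := by ring

/-! ### Lipschitz functions belong to the Morrey space -/

lemma arcLength_pos {a b : ℝ} (h : IsArc a b) : 0 < arcLength a b :=
  div_pos (sub_pos.mpr h.1) Real.two_pi_pos

lemma arcLength_le_one {a b : ℝ} (h : IsArc a b) : arcLength a b ≤ 1 :=
  (div_le_one Real.two_pi_pos).mpr (by linarith [h.2])

lemma sub_eq_arcLength (a b : ℝ) : b - a = 2 * Real.pi * arcLength a b := by
  unfold arcLength; field_simp

lemma arcMean_eq (F : Circle → ℂ) (a b : ℝ) :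
    arcMean F a b = (b - a)⁻¹ • ∫ θ in Icc a b, F (Circle.exp θ) := by
  rw [arcMean, arcLength, Complex.real_smul]
  congr 2
  have := Real.pi_pos
  field_simp

lemma norm_sub_arcMean_le {F : Circle → ℂ} (hF : Continuous F) {a b M : ℝ} (hab : a < b) {c : ℂ}
    (hM : ∀ s ∈ Icc a b, ‖c - F (Circle.exp s)‖ ≤ M) : ‖c - arcMean F a b‖ ≤ M := by
  have hFc : Continuous fun s : ℝ => F (Circle.exp s) := hF.comp Circle.exp.continuous
  have hvol : (volume : Measure ℝ).real (Icc a b) = b - a := by simp [hab.le]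
  have hba : 0 < b - a := sub_pos.mpr hab
  have : c - arcMean F a b = (b - a)⁻¹ • ∫ s in Icc a b, (c - F (Circle.exp s)) := by
    rw [integral_sub (by simp) hFc.integrableOn_Icc, arcMean_eq, smul_sub, setIntegral_const, hvol,
      inv_smul_smul₀ hba.ne']
  rw [this, norm_smul, norm_inv, Real.norm_of_nonneg hba.le, inv_mul_le_iff₀ hba, mul_comm]
  simpa [hvol] using norm_setIntegral_le_of_norm_le_const (μ := volume) (by simp) hM

lemma norm_exp_sub_exp_le (s t : ℝ) :
    ‖Complex.exp (s * Complex.I) - Complex.exp (t * Complex.I)‖ ≤ |s - t| := by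
  have h : Complex.exp (s * Complex.I) - Complex.exp (t * Complex.I) =
      Complex.exp (t * Complex.I) * (Complex.exp (Complex.I * ((s - t : ℝ) : ℂ)) - 1) := by
    rw [mul_sub, ← Complex.exp_add]
    push_cast
    ring_nf
  rw [h, norm_mul, Complex.norm_exp_ofReal_mul_I, one_mul]
  exact Real.norm_exp_I_mul_ofReal_sub_one_le

lemma memHardy_of_norm_le {f : ℂ → ℂ} (hf : Holo f) {M : ℝ} (hM : ∀ z ∈ disc, ‖f z‖ ≤ M) :
    MemHardy f := by
  refine ⟨hf, lt_of_le_of_lt (b := ENNReal.ofReal (1 / (2 * Real.pi)) *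
    (ENNReal.ofReal M ^ 2 * volume (Icc (0 : ℝ) (2 * Real.pi)))) ?_ ?_⟩
  · refine iSup₂_le fun r hr => ?_
    gcongr
    rw [← setLIntegral_const]
    refine lintegral_mono fun θ => ?_
    gcongr
    rw [← ofReal_norm]
    refine ENNReal.ofReal_le_ofReal (hM _ ?_)
    simpa [mem_disc, abs_of_pos hr.1] using hr.2
  · exact ENNReal.mul_lt_top ENNReal.ofReal_lt_top
      (ENNReal.mul_lt_top (ENNReal.pow_lt_top ENNReal.ofReal_lt_top) measure_Icc_lt_top)

/-- Functions which are holomorphic in the disc and Lipschitz up to the boundary belong to every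
analytic Morrey space. -/
lemma memMorrey_of_lipschitzOnWith {lam : ℝ} (h1 : lam < 1) {f : ℂ → ℂ} (hf : Holo f) {L : ℝ≥0}
    (hL : LipschitzOnWith L f (Metric.closedBall 0 1)) : MemMorrey lam f := by
  have hcont := hL.continuousOn
  have hmem : ∀ ζ : Circle, (ζ : ℂ) ∈ Metric.closedBall (0 : ℂ) 1 := fun ζ => by simp [Circle.norm_coe]
  have hF : Continuous fun ζ : Circle => f ζ :=
    hcont.comp_continuous continuous_subtype_val hmem
  obtain ⟨M, hM⟩ := (isCompact_closedBall (0 : ℂ) 1).exists_bound_of_continuousOn hcont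
  refine ⟨memHardy_of_norm_le hf fun z hz => hM z (Metric.ball_subset_closedBall hz),
    fun ζ => f ζ, Eventually.of_forall fun θ => ?_, ?_⟩
  · have hz : (Circle.exp θ : ℂ) ∈ Metric.closedBall (0 : ℂ) 1 := hmem _
    have hlim : Tendsto (fun r : ℝ => (r * Complex.exp (θ * Complex.I) : ℂ)) (𝓝[<] 1)
        (𝓝[Metric.closedBall 0 1] (Circle.exp θ : ℂ)) := by
      refine tendsto_nhdsWithin_iff.mpr ⟨?_, ?_⟩
      · have : Tendsto (fun r : ℝ => (r * Complex.exp (θ * Complex.I) : ℂ)) (𝓝 1)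
            (𝓝 ((1 : ℝ) * Complex.exp (θ * Complex.I))) :=
          Continuous.tendsto (by fun_prop) _
        simpa using this.mono_left nhdsWithin_le_nhds
      · filter_upwards [Ioo_mem_nhdsLT (zero_lt_one' ℝ)] with r hr
        simpa [abs_of_pos hr.1] using hr.2.le
    exact (hcont _ hz).tendsto.comp hlim
  · refine lt_of_le_of_lt (b := ENNReal.ofReal ((2 * Real.pi * L) ^ 2) ^ (1 / 2 : ℝ)) ?_
      (ENNReal.rpow_lt_top_of_nonneg (by norm_num) ENNReal.ofReal_ne_top)
    refine iSup₂_le fun a b => iSup_le fun hab => ?_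
    have hpi := Real.pi_pos
    have hlen := arcLength_pos hab
    have hlen1 := arcLength_le_one hab
    have hba := sub_eq_arcLength a b
    set h := arcLength a b
    gcongr
    have hosc : ∀ θ ∈ Icc a b,
        ‖f (Circle.exp θ) - arcMean (fun ζ : Circle => f ζ) a b‖ₑ ^ 2 ≤
          ENNReal.ofReal ((2 * Real.pi * L * h) ^ 2) := by
      intro θ hθ
      rw [← ofReal_norm, ← ENNReal.ofReal_pow (norm_nonneg _)]
      refine ENNReal.ofReal_le_ofReal ?_
      gcongr
      refine norm_sub_arcMean_le hF hab.1 fun s hs => ?_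
      calc ‖f (Circle.exp θ) - f (Circle.exp s)‖
          ≤ L * ‖(Circle.exp θ : ℂ) - Circle.exp s‖ := hL.norm_sub_le (hmem _) (hmem _)
        _ ≤ L * (b - a) := by
            gcongr
            rw [Circle.coe_exp, Circle.coe_exp]
            refine (norm_exp_sub_exp_le θ s).trans (abs_le.mpr ⟨?_, ?_⟩) <;>
              linarith [hs.1, hs.2, hθ.1, hθ.2]
        _ = 2 * Real.pi * L * h := by rw [hba]; ring
    calc _ ≤ ENNReal.ofReal (1 / h ^ lam) * (ENNReal.ofReal (1 / (2 * Real.pi)) *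
          (ENNReal.ofReal ((2 * Real.pi * L * h) ^ 2) * ENNReal.ofReal (b - a))) := by
          gcongr
          rw [← Real.volume_Icc, ← setLIntegral_const]
          exact setLIntegral_mono' measurableSet_Icc hosc
      _ = ENNReal.ofReal ((2 * Real.pi * L) ^ 2 * (h ^ 3 / h ^ lam)) := by
          rw [hba, ← ENNReal.ofReal_mul (by positivity), ← ENNReal.ofReal_mul (by positivity),
            ← ENNReal.ofReal_mul (by positivity)]
          congr 1
          field_simp
      _ ≤ _ := by
          refine ENNReal.ofReal_le_ofReal (mul_le_of_le_one_right (by positivity) ?_)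
          rw [div_le_one (Real.rpow_pos_of_pos hlen _), ← Real.rpow_natCast]
          exact Real.rpow_le_rpow_of_exponent_ge hlen hlen1 (by push_cast; linarith)

/-! ### Test functions -/

/-- The test function `(1 - |w|²)^{(λ+1)/2} z / (1 - w̄ z)`, which vanishes at the origin and whose
derivative `(1 - |w|²)^{(λ+1)/2} / (1 - w̄ z)²` peaks near `w`. -/
noncomputable def testFun (lam : ℝ) (w z : ℂ) : ℂ :=
  ((1 - ‖w‖ ^ 2) ^ ((lam + 1) / 2) : ℝ) * (z / (1 - starRingEnd ℂ w * z))

lemma one_sub_mul_le_norm (w z : ℂ) : 1 - ‖w‖ * ‖z‖ ≤ ‖1 - starRingEnd ℂ w * z‖ := by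
  simpa using norm_sub_norm_le (1 : ℂ) (starRingEnd ℂ w * z)

lemma one_sub_norm_le_norm (w : ℂ) {z : ℂ} (hz : ‖z‖ ≤ 1) :
    1 - ‖w‖ ≤ ‖1 - starRingEnd ℂ w * z‖ := by
  nlinarith [one_sub_mul_le_norm w z, norm_nonneg w]

lemma hasDerivAt_testFun (lam : ℝ) {w z : ℂ} (hw : w ∈ disc) (hz : ‖z‖ ≤ 1) :
    HasDerivAt (testFun lam w)
      (((1 - ‖w‖ ^ 2) ^ ((lam + 1) / 2) : ℝ) * (1 / (1 - starRingEnd ℂ w * z) ^ 2)) z := by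
  have h0 : 1 - starRingEnd ℂ w * z ≠ 0 := by
    rw [← norm_pos_iff]
    linarith [one_sub_norm_le_norm w hz, mem_disc.mp hw]
  have h1 : HasDerivAt (fun z => 1 - starRingEnd ℂ w * z) (-starRingEnd ℂ w) z := by
    simpa using ((hasDerivAt_id z).const_mul (starRingEnd ℂ w)).const_sub 1
  have h2 := ((hasDerivAt_id z).div h1 h0).const_mul
    (((1 - ‖w‖ ^ 2) ^ ((lam + 1) / 2) : ℝ) : ℂ)
  exact h2.congr_deriv (by simp only [id]; ring)

lemma holo_testFun (lam : ℝ) {w : ℂ} (hw : w ∈ disc) : Holo (testFun lam w) := fun _ hz =>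
  (hasDerivAt_testFun lam hw (mem_disc.mp hz).le).differentiableAt.differentiableWithinAt

lemma memMorrey_testFun {lam : ℝ} (h1 : lam < 1) {w : ℂ} (hw : w ∈ disc) :
    MemMorrey lam (testFun lam w) := by
  have hw1 := mem_disc.mp hw
  set A : ℝ := (1 - ‖w‖ ^ 2) ^ ((lam + 1) / 2)
  refine memMorrey_of_lipschitzOnWith (L := ‖A‖₊ * (1 / ⟨(1 - ‖w‖) ^ 2, by positivity⟩))
    h1 (holo_testFun lam hw) ?_
  refine (convex_closedBall (0 : ℂ) 1).lipschitzOnWith_of_nnnorm_hasDerivWithin_le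
    (fun z hz => (hasDerivAt_testFun lam hw (by simpa using hz)).hasDerivWithinAt) fun z hz => ?_
  have hz' : ‖z‖ ≤ 1 := by simpa using hz
  rw [← NNReal.coe_le_coe]
  push_cast
  rw [norm_mul, Complex.norm_real, norm_div, norm_one, norm_pow]
  have := one_sub_norm_le_norm w hz'
  have : 0 < 1 - ‖w‖ := by linarith
  change _ ≤ _ * (1 / (1 - ‖w‖) ^ 2)
  gcongr

/-- The mean of the Poisson kernel over the unit circle is `1`. -/
lemma lintegral_circle_inv_sq {w : ℂ} (hw : w ∈ disc) {r : ℝ} (hr : r ∈ Ioo (0 : ℝ) 1) :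
    ∫⁻ θ in Ioo (-Real.pi) Real.pi,
      ENNReal.ofReal (1 / ‖1 - starRingEnd ℂ w * circleMap 0 r θ‖ ^ 2) =
    ENNReal.ofReal (2 * Real.pi / (1 - (‖w‖ * r) ^ 2)) := by
  have hw1 := mem_disc.mp hw
  have hnorm : ‖(r : ℂ) * w‖ = ‖w‖ * r := by
    rw [norm_mul, Complex.norm_real, Real.norm_of_nonneg hr.1.le, mul_comm]
  have hwr : ‖w‖ * r < 1 := by nlinarith [norm_nonneg w, hr.1, hr.2]
  have hwr0 : 0 ≤ ‖w‖ * r := by nlinarith [norm_nonneg w, hr.1]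
  have hc : 0 < 1 - (‖w‖ * r) ^ 2 := by nlinarith
  have hden : ∀ θ : ℝ, ‖1 - starRingEnd ℂ w * circleMap 0 r θ‖ = ‖circleMap 0 1 θ - r * w‖ := by
    intro θ
    have h2 : starRingEnd ℂ (circleMap 0 1 θ) * circleMap 0 1 θ = 1 := by
      rw [Complex.conj_mul']; simp
    have h3 : circleMap 0 r θ = r * circleMap 0 1 θ := by simp [circleMap]
    calc ‖1 - starRingEnd ℂ w * circleMap 0 r θ‖
        = ‖starRingEnd ℂ (circleMap 0 1 θ - r * w) * circleMap 0 1 θ‖ := by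
          rw [map_sub, map_mul, Complex.conj_ofReal, sub_mul, h2, h3]
          ring_nf
      _ = _ := by rw [norm_mul, Complex.norm_conj, norm_circleMap_zero, abs_one, mul_one]
  have hpos : ∀ θ : ℝ, 0 < ‖1 - starRingEnd ℂ w * circleMap 0 r θ‖ := fun θ => by
    have := one_sub_mul_le_norm w (circleMap 0 r θ)
    rw [norm_circleMap_zero, abs_of_pos hr.1] at this
    linarith
  have hball : (r : ℂ) * w ∈ Metric.ball (0 : ℂ) 1 := by rwa [mem_ball_zero_iff, hnorm]
  have hP := DiffContOnCl.circleAverage_poissonKernel_smul' (f := fun _ => (1 : ℂ))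
    diffContOnCl_const hball
  rw [circleAverage_eq_integral_Ioo, integral_smul_const, inv_smul_eq_iff₀ (by positivity)] at hP
  have hP' : ∫ θ in Ioo (-Real.pi) Real.pi,
      (1 - (‖w‖ * r) ^ 2) * (1 / ‖1 - starRingEnd ℂ w * circleMap 0 r θ‖ ^ 2) = 2 * Real.pi := by
    simp only [sub_zero, norm_circleMap_zero, abs_one, hnorm, one_pow, Complex.real_smul,
      mul_one] at hP
    simp only [hden, mul_one_div]
    exact_mod_cast hP
  rw [integral_const_mul] at hP'
  rw [← ofReal_integral_eq_lintegral_ofReal, eq_div_of_mul_eq hc.ne' ((mul_comm _ _).trans hP')]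
  · refine (Continuous.integrableOn_Icc ?_).mono_set Ioo_subset_Icc_self
    have := fun θ => (pow_pos (hpos θ) 2).ne'
    fun_prop (disch := simpa)
  · exact Eventually.of_forall fun θ => by positivity

/-- The energy of a test function over the whole disc, up to normalization: two of the four factors
of the denominator are estimated by `1 - |w| |z|`, the other two form a Poisson kernel. -/
lemma lintegral_disc_le {w : ℂ} (hw : w ∈ disc) :
    ∫⁻ z in disc, ENNReal.ofReal (1 / ‖1 - starRingEnd ℂ w * z‖ ^ 4 * (1 - ‖z‖ ^ 2)) ∂area ≤
      ENNReal.ofReal (8 / (1 - ‖w‖ ^ 2)) := by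
  have hw1 := mem_disc.mp hw
  have hpi := Real.pi_pos
  have hw0 := norm_nonneg w
  have hwr : ∀ r ∈ Icc (0 : ℝ) 1, 0 < 1 - ‖w‖ * r := fun r hr => by nlinarith [hr.1, hr.2]
  have hcirc : ∀ r ∈ Ioo (0 : ℝ) 1, ENNReal.ofReal r * ∫⁻ θ in Ioo (-Real.pi) Real.pi,
      ENNReal.ofReal (1 / ‖1 - starRingEnd ℂ w * circleMap 0 r θ‖ ^ 4 *
        (1 - ‖circleMap 0 r θ‖ ^ 2)) ≤ ENNReal.ofReal (4 * Real.pi * (1 / (1 - ‖w‖ * r) ^ 2)) := by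
    intro r hr
    have hpos := hwr r ⟨hr.1.le, hr.2.le⟩
    have hr2 : 0 ≤ 1 - r ^ 2 := by nlinarith [hr.1, hr.2]
    have hwr0 : 0 ≤ ‖w‖ * r := mul_nonneg hw0 hr.1.le
    calc _ ≤ ENNReal.ofReal r * ∫⁻ θ in Ioo (-Real.pi) Real.pi,
          ENNReal.ofReal ((1 - r ^ 2) / (1 - ‖w‖ * r) ^ 2) *
            ENNReal.ofReal (1 / ‖1 - starRingEnd ℂ w * circleMap 0 r θ‖ ^ 2) := by
          gcongr with θ
          rw [← ENNReal.ofReal_mul (by positivity)]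
          refine ENNReal.ofReal_le_ofReal ?_
          have h1 := one_sub_mul_le_norm w (circleMap 0 r θ)
          rw [norm_circleMap_zero, abs_of_pos hr.1] at h1 ⊢
          set D := ‖1 - starRingEnd ℂ w * circleMap 0 r θ‖
          have hD : 0 < D := hpos.trans_le h1
          calc 1 / D ^ 4 * (1 - r ^ 2) = (1 - r ^ 2) / D ^ 2 * (1 / D ^ 2) := by field_simp
            _ ≤ _ := by gcongr
      _ = ENNReal.ofReal (r * ((1 - r ^ 2) / (1 - ‖w‖ * r) ^ 2 *
            (2 * Real.pi / (1 - (‖w‖ * r) ^ 2)))) := by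
          rw [lintegral_const_mul' _ _ ENNReal.ofReal_ne_top, lintegral_circle_inv_sq hw hr,
            ← ENNReal.ofReal_mul (by positivity), ← ENNReal.ofReal_mul hr.1.le]
      _ ≤ _ := by
          refine ENNReal.ofReal_le_ofReal ?_
          have h2 : 1 - r ≤ 1 - ‖w‖ * r := by nlinarith [hr.1]
          have h3 : 1 - (‖w‖ * r) ^ 2 = (1 - ‖w‖ * r) * (1 + ‖w‖ * r) := by ring
          have h4 : r * ((1 - r ^ 2) * 2) ≤ 4 * ((1 - ‖w‖ * r) * (1 + ‖w‖ * r)) := by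
            have h6 : (‖w‖ * r) ^ 2 ≤ r ^ 2 := by
              gcongr
              exact mul_le_of_le_one_left hr.1.le hw1.le
            nlinarith [hr.1, hr.2, mul_nonneg (sub_nonneg.mpr hr.2.le) hr2]
          have h5 : 0 < (1 - ‖w‖ * r) * (1 + ‖w‖ * r) := by positivity
          rw [h3]
          calc _ = Real.pi * (1 / (1 - ‖w‖ * r) ^ 2) *
                (r * ((1 - r ^ 2) * 2) / ((1 - ‖w‖ * r) * (1 + ‖w‖ * r))) := by ring
            _ ≤ Real.pi * (1 / (1 - ‖w‖ * r) ^ 2) * 4 := by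
                gcongr
                rwa [div_le_iff₀ h5]
            _ = _ := by ring
  have hint : ∫ r in Ioo (0 : ℝ) 1, 4 * Real.pi * (1 / (1 - ‖w‖ * r) ^ 2) =
      4 * Real.pi * (1 / (1 - ‖w‖)) := by
    rw [← integral_Ioc_eq_integral_Ioo, ← intervalIntegral.integral_of_le zero_le_one]
    have hd : ∀ r ∈ uIcc (0 : ℝ) 1, HasDerivAt (fun r => 4 * Real.pi * (r / (1 - ‖w‖ * r)))
        (4 * Real.pi * (1 / (1 - ‖w‖ * r) ^ 2)) r := by
      intro r hr
      rw [uIcc_of_le zero_le_one] at hr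
      have h0 := (hwr r hr).ne'
      have h1 : HasDerivAt (fun r => 1 - ‖w‖ * r) (-‖w‖) r := by
        simpa using ((hasDerivAt_id r).const_mul ‖w‖).const_sub 1
      exact (((hasDerivAt_id r).div h1 h0).const_mul (4 * Real.pi)).congr_deriv (by simp only [id]; ring)
    rw [intervalIntegral.integral_eq_sub_of_hasDerivAt hd]
    · simp
    · refine ContinuousOn.intervalIntegrable fun r hr => ContinuousAt.continuousWithinAt ?_
      rw [uIcc_of_le zero_le_one] at hr
      have := (pow_pos (hwr r hr) 2).ne'
      fun_prop (disch := assumption)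
  have hmeas : Measurable fun z : ℂ =>
      ENNReal.ofReal (1 / ‖1 - starRingEnd ℂ w * z‖ ^ 4 * (1 - ‖z‖ ^ 2)) := by fun_prop
  rw [area, Measure.restrict_smul, lintegral_smul_measure, smul_eq_mul, disc,
    lintegral_ball_eq_polar hmeas]
  calc _ ≤ ENNReal.ofReal (1 / Real.pi) *
        ∫⁻ r in Ioo (0 : ℝ) 1, ENNReal.ofReal (4 * Real.pi * (1 / (1 - ‖w‖ * r) ^ 2)) := by
        gcongr 1
        exact setLIntegral_mono' measurableSet_Ioo hcirc
    _ = ENNReal.ofReal (4 / (1 - ‖w‖)) := by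
        rw [← ofReal_integral_eq_lintegral_ofReal, hint, ← ENNReal.ofReal_mul (by positivity)]
        · congr 1
          field_simp
        · refine (ContinuousOn.integrableOn_Icc fun r hr =>
            ContinuousAt.continuousWithinAt ?_).mono_set Ioo_subset_Icc_self
          have := (pow_pos (hwr r hr) 2).ne'
          fun_prop (disch := assumption)
        · exact Eventually.of_forall fun r => by positivity
    _ ≤ _ := by
        refine ENNReal.ofReal_le_ofReal ?_
        rw [div_le_div_iff₀ (by linarith) (by nlinarith)]
        nlinarith

/-- The constant comes from `1 + 2 π ≤ 8`. -/
lemma carlesonBox_subset_closedBall {a b : ℝ} (h : IsArc a b) :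
    carlesonBox a b ⊆ Metric.closedBall (Complex.exp (a * Complex.I)) (8 * arcLength a b) := by
  rintro z ⟨hz1, hz2, θ, hθ, hz⟩
  have hlen := arcLength_pos h
  have hba := sub_eq_arcLength a b
  have hpi := Real.pi_lt_d2
  rw [Metric.mem_closedBall, dist_eq_norm]
  have h1 : ‖z - Complex.exp (θ * Complex.I)‖ ≤ arcLength a b := by
    have : z - Complex.exp (θ * Complex.I) = ((‖z‖ - 1 : ℝ) : ℂ) * Complex.exp (θ * Complex.I) := by
      conv_lhs => rw [hz]
      push_cast
      ring
    rw [this, norm_mul, Complex.norm_exp_ofReal_mul_I, mul_one, Complex.norm_real,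
      Real.norm_eq_abs, abs_sub_comm, abs_of_nonneg (by linarith)]
    linarith
  have h2 := norm_exp_sub_exp_le θ a
  rw [abs_of_nonneg (by linarith [hθ.1])] at h2
  have h3 := norm_sub_le_norm_sub_add_norm_sub z (Complex.exp (θ * Complex.I))
    (Complex.exp (a * Complex.I))
  nlinarith [hθ.2]

/-- The energy of a test function over a Carleson box, up to normalization, estimated by the maximum
of the integrand. -/
lemma lintegral_carlesonBox_le {w : ℂ} (hw : w ∈ disc) {a b : ℝ} (h : IsArc a b) :
    ∫⁻ z in carlesonBox a b,
        ENNReal.ofReal (1 / ‖1 - starRingEnd ℂ w * z‖ ^ 4 * (1 - ‖z‖ ^ 2)) ∂area ≤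
      ENNReal.ofReal (2048 * arcLength a b ^ 3 / (1 - ‖w‖ ^ 2) ^ 4) := by
  have hw1 := mem_disc.mp hw
  have hw0 := norm_nonneg w
  have hlen := arcLength_pos h
  have hδ : 0 < 1 - ‖w‖ ^ 2 := by nlinarith
  have harea : area (carlesonBox a b) ≤ ENNReal.ofReal (64 * arcLength a b ^ 2) := by
    refine (measure_mono (carlesonBox_subset_closedBall h)).trans ?_
    have hpi : (NNReal.pi : ℝ≥0∞) = ENNReal.ofReal Real.pi := by
      rw [← NNReal.coe_real_pi, ENNReal.ofReal_coe_nnreal]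
    rw [area, Measure.smul_apply, smul_eq_mul, Complex.volume_closedBall, hpi,
      ← ENNReal.ofReal_pow (by positivity), ← ENNReal.ofReal_mul (by positivity),
      ← ENNReal.ofReal_mul (by positivity)]
    refine ENNReal.ofReal_le_ofReal (le_of_eq ?_)
    have := Real.pi_pos
    field_simp
    norm_num
  calc _ ≤ ∫⁻ z in carlesonBox a b,
        ENNReal.ofReal (32 * arcLength a b / (1 - ‖w‖ ^ 2) ^ 4) ∂area := by
        refine setLIntegral_mono measurable_const fun z hz => ENNReal.ofReal_le_ofReal ?_
        have h1 := one_sub_norm_le_norm w hz.2.1.le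
        have h2 : (1 - ‖w‖ ^ 2) / 2 ≤ ‖1 - starRingEnd ℂ w * z‖ := by nlinarith
        have h3 : 0 ≤ 1 - ‖z‖ ^ 2 := by nlinarith [norm_nonneg z, hz.2.1]
        calc _ ≤ 1 / ((1 - ‖w‖ ^ 2) / 2) ^ 4 * (2 * arcLength a b) := by
              gcongr
              nlinarith [hz.1, hz.2.1]
          _ = _ := by field_simp; norm_num
    _ ≤ ENNReal.ofReal (32 * arcLength a b / (1 - ‖w‖ ^ 2) ^ 4) *
          ENNReal.ofReal (64 * arcLength a b ^ 2) := by
        rw [setLIntegral_const]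
        gcongr
    _ = _ := by
        rw [← ENNReal.ofReal_mul (by positivity)]
        ring_nf

/-- The test functions are bounded in the Morrey space. -/
lemma morreyNorm_testFun_le {lam : ℝ} (h0 : 0 < lam) (h1 : lam < 1) {w : ℂ} (hw : w ∈ disc) :
    morreyNorm lam (testFun lam w) ≤ 46 := by
  have hw1 := mem_disc.mp hw
  have hδ : 0 < 1 - ‖w‖ ^ 2 := by nlinarith [norm_nonneg w]
  have hzero : testFun lam w 0 = 0 := by simp [testFun]
  rw [morreyNorm, hzero, enorm_zero, zero_add]
  refine iSup₂_le fun a b => iSup_le fun hab => ?_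
  have hlen := arcLength_pos hab
  set δ := 1 - ‖w‖ ^ 2 with hδdef
  set h := arcLength a b with hh
  set J := ∫⁻ z in carlesonBox a b,
    ENNReal.ofReal (1 / ‖1 - starRingEnd ℂ w * z‖ ^ 4 * (1 - ‖z‖ ^ 2)) ∂area with hJ
  have hI : ∫⁻ z in carlesonBox a b, ‖deriv (testFun lam w) z‖ₑ ^ 2 *
      ENNReal.ofReal (1 - ‖z‖ ^ 2) ∂area ≤ ENNReal.ofReal (δ ^ (lam + 1)) * J := by
    rw [hJ, ← lintegral_const_mul' _ _ ENNReal.ofReal_ne_top]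
    refine setLIntegral_mono (by fun_prop) fun z hz => le_of_eq ?_
    rw [(hasDerivAt_testFun lam hw hz.2.1.le).deriv, ← ofReal_norm, norm_mul, Complex.norm_real,
      Real.norm_of_nonneg (by positivity), ← ENNReal.ofReal_pow (by positivity),
      ← ENNReal.ofReal_mul (by positivity), ← ENNReal.ofReal_mul (by positivity)]
    congr 1
    rw [mul_pow, ← Real.rpow_mul_natCast hδ.le, norm_div, norm_one, norm_pow]
    push_cast
    ring_nf
  have hJ2 : ENNReal.ofReal (1 / h ^ lam) * (ENNReal.ofReal (δ ^ (lam + 1)) * J) ≤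
      ENNReal.ofReal (46 ^ 2) := by
    -- the two bounds below meet where the arc has length comparable to `1 - |w|²`
    rcases le_total h δ with hle | hle
    · have hb := lintegral_carlesonBox_le hw hab
      calc _ ≤ ENNReal.ofReal (1 / h ^ lam) * (ENNReal.ofReal (δ ^ (lam + 1)) *
            ENNReal.ofReal (2048 * h ^ 3 / δ ^ 4)) := by gcongr
        _ = ENNReal.ofReal (2048 * (h / δ) ^ (3 - lam)) := by
          rw [← ENNReal.ofReal_mul (by positivity), ← ENNReal.ofReal_mul (by positivity),
            Real.div_rpow hlen.le hδ.le, Real.rpow_sub hlen, Real.rpow_sub hδ,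
            Real.rpow_add_one hδ.ne']
          congr 1
          norm_cast
          field_simp
        _ ≤ _ := by
          refine ENNReal.ofReal_le_ofReal ?_
          have := Real.rpow_le_one (div_nonneg hlen.le hδ.le) ((div_le_one hδ).mpr hle)
            (by linarith : 0 ≤ 3 - lam)
          linarith
    · have hb : J ≤ ENNReal.ofReal (8 / δ) :=
        (lintegral_mono_set fun z hz => mem_disc.mpr hz.2.1).trans (lintegral_disc_le hw)
      calc _ ≤ ENNReal.ofReal (1 / h ^ lam) * (ENNReal.ofReal (δ ^ (lam + 1)) *
            ENNReal.ofReal (8 / δ)) := by gcongr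
        _ = ENNReal.ofReal (8 * (δ / h) ^ lam) := by
          rw [← ENNReal.ofReal_mul (by positivity), ← ENNReal.ofReal_mul (by positivity),
            Real.div_rpow hδ.le hlen.le, Real.rpow_add_one hδ.ne']
          congr 1
          field_simp
        _ ≤ _ := by
          refine ENNReal.ofReal_le_ofReal ?_
          have := Real.rpow_le_one (div_nonneg hδ.le hlen.le) ((div_le_one hlen).mpr hle) h0.le
          linarith
  -- `46² ≥ 2048`, the larger of the two constants
  calc _ ≤ ENNReal.ofReal (46 ^ 2) ^ (1 / 2 : ℝ) := by
        gcongr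
        exact (mul_le_mul_right hI _).trans hJ2
    _ = 46 := by
        rw [ENNReal.ofReal_rpow_of_nonneg (by norm_num) (by norm_num), ← Real.sqrt_eq_rpow,
          Real.sqrt_sq (by norm_num), ENNReal.ofReal_ofNat]

/-- The weighted norm is bounded by every admissible constant for `I_g`. -/
theorem weightedNorm_le_of_blochNorm_le {lam : ℝ} (h0 : 0 < lam) (h1 : lam < 1) {g : ℂ → ℂ}
    (hg : Holo g) {K : ℝ≥0∞}
    (hK : ∀ f, MemMorrey lam f → blochNorm (opI g f) ≤ K * morreyNorm lam f) :
    weightedNorm ((lam - 1) / 2) g ≤ K * 46 := by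
  refine iSup₂_le fun w hw => ?_
  have hw1 := mem_disc.mp hw
  have hδ : 0 < 1 - ‖w‖ ^ 2 := by nlinarith [norm_nonneg w]
  calc ENNReal.ofReal ((1 - ‖w‖ ^ 2) ^ ((lam - 1) / 2) * ‖g w‖)
      = ENNReal.ofReal ((1 - ‖w‖ ^ 2) * ‖deriv (testFun lam w) w * g w‖) := by
        rw [(hasDerivAt_testFun lam hw hw1.le).deriv]
        congr 1
        have hc : 1 - starRingEnd ℂ w * w = ((1 - ‖w‖ ^ 2 : ℝ) : ℂ) := by
          rw [Complex.conj_mul']; push_cast; rfl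
        have hp : (1 - ‖w‖ ^ 2) ^ ((lam + 1) / 2) =
            (1 - ‖w‖ ^ 2) ^ ((lam - 1) / 2) * (1 - ‖w‖ ^ 2) := by
          rw [← Real.rpow_add_one hδ.ne']
          ring_nf
        rw [hc, norm_mul, norm_mul, norm_div, norm_one, norm_pow, Complex.norm_real,
          Complex.norm_real, Real.norm_of_nonneg hδ.le, Real.norm_of_nonneg (by positivity), hp]
        field_simp
    _ ≤ blochNorm (opI g (testFun lam w)) := by
        rw [blochNorm_opI hg (holo_testFun lam hw)]
        exact le_iSup₂_of_le w hw le_rfl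
    _ ≤ K * morreyNorm lam (testFun lam w) := hK _ (memMorrey_testFun h1 hw)
    _ ≤ K * 46 := by
        gcongr
        exact morreyNorm_testFun_le h0 h1 hw

/-! ### Boundary values and Cauchy's formula in the Hardy space -/

/-- A sequence which is bounded in `L²` of a finite measure space is uniformly integrable. -/
lemma unifIntegrable_of_eLpNorm_two_le {α E : Type*} {m : MeasurableSpace α} {μ : Measure α}
    [NormedAddCommGroup E] {g : ℕ → α → E} (hg : ∀ n, AEStronglyMeasurable (g n) μ) {B : ℝ≥0}
    (hB : ∀ n, eLpNorm (g n) 2 μ ≤ B) : UnifIntegrable g 1 μ := by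
  intro ε hε
  refine ⟨(ε / (B + 1)) ^ 2, by positivity, fun n s hs hμs => ?_⟩
  rw [eLpNorm_indicator_eq_eLpNorm_restrict hs]
  calc eLpNorm (g n) 1 (μ.restrict s)
      ≤ eLpNorm (g n) 2 (μ.restrict s) * μ.restrict s univ ^
          (1 / (1 : ℝ≥0∞).toReal - 1 / (2 : ℝ≥0∞).toReal) :=
        eLpNorm_le_eLpNorm_mul_rpow_measure_univ (by norm_num) (hg n).restrict
    _ ≤ B * ENNReal.ofReal ((ε / (B + 1)) ^ 2) ^ (1 / 2 : ℝ) := by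
        have : 1 / (1 : ℝ≥0∞).toReal - 1 / (2 : ℝ≥0∞).toReal = (1 / 2 : ℝ) := by norm_num
        rw [this, Measure.restrict_apply_univ]
        gcongr
        exact (eLpNorm_restrict_le _ _ _ _).trans (hB n)
    _ = ENNReal.ofReal (B * (ε / (B + 1))) := by
        rw [ENNReal.ofReal_rpow_of_nonneg (by positivity) (by norm_num), ← Real.sqrt_eq_rpow,
          Real.sqrt_sq (by positivity), ENNReal.ofReal_mul (by positivity),
          ENNReal.ofReal_coe_nnreal]
    _ ≤ ENNReal.ofReal ε := by
        refine ENNReal.ofReal_le_ofReal ?_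
        rw [mul_div_assoc', div_le_iff₀ (by positivity)]
        nlinarith [B.coe_nonneg]

/-- Almost everywhere convergence together with boundedness in `L²` of a finite measure space
allows passing to the limit under the integral sign. -/
lemma tendsto_integral_of_eLpNorm_two_le {α E : Type*} {m : MeasurableSpace α} {μ : Measure α}
    [IsFiniteMeasure μ] [NormedAddCommGroup E] [NormedSpace ℝ E] {g : ℕ → α → E} {G : α → E}
    (hg : ∀ n, AEStronglyMeasurable (g n) μ) {B : ℝ≥0} (hB : ∀ n, eLpNorm (g n) 2 μ ≤ B)
    (hlim : ∀ᵐ x ∂μ, Tendsto (fun n => g n x) atTop (𝓝 (G x))) :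
    MemLp G 2 μ ∧ Tendsto (fun n => ∫ x, g n x ∂μ) atTop (𝓝 (∫ x, G x ∂μ)) := by
  have hG : MemLp G 2 μ := by
    refine ⟨aestronglyMeasurable_of_tendsto_ae atTop hg hlim, ?_⟩
    refine (Lp.eLpNorm_lim_le_liminf_eLpNorm hg G hlim).trans_lt (lt_of_le_of_lt ?_
      (ENNReal.coe_lt_top (r := B)))
    exact (liminf_le_liminf (Eventually.of_forall hB)).trans_eq (liminf_const _)
  refine ⟨hG, tendsto_integral_of_L1' G hG.1 ?_ ?_⟩
  · exact Eventually.of_forall fun n =>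
      MemLp.integrable (q := 2) (by norm_num) ⟨hg n, (hB n).trans_lt ENNReal.coe_lt_top⟩
  · exact tendsto_Lp_finite_of_tendsto_ae le_rfl (by norm_num) hg (hG.mono_exponent (by norm_num))
      (unifIntegrable_of_eLpNorm_two_le hg hB) hlim

/-- Radii increasing to `1`. -/
lemma exists_seq_radii : ∃ r : ℕ → ℝ, (∀ n, r n ∈ Ioo (0 : ℝ) 1) ∧ Tendsto r atTop (𝓝[<] 1) := by
  obtain ⟨r, -, hr, hlim⟩ := exists_seq_strictMono_tendsto' (zero_lt_one' ℝ)
  exact ⟨r, hr, tendsto_nhdsWithin_iff.mpr ⟨hlim, Eventually.of_forall fun n => (hr n).2⟩⟩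

lemma Holo.continuous_circle {f : ℂ → ℂ} (hf : Holo f) {r : ℝ} (hr : r ∈ Ioo (0 : ℝ) 1) :
    Continuous fun θ : ℝ => f (r * Complex.exp (θ * Complex.I)) := by
  refine hf.continuousOn.comp_continuous (by fun_prop) fun θ => ?_
  simpa [mem_disc, abs_of_pos hr.1] using hr.2

/-- The circle means of a Hardy function are bounded in `L²`. -/
lemma MemHardy.exists_eLpNorm_le {f : ℂ → ℂ} (hf : MemHardy f) :
    ∃ B : ℝ≥0, ∀ r ∈ Ioo (0 : ℝ) 1,
      eLpNorm (fun θ : ℝ => f (r * Complex.exp (θ * Complex.I))) 2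
        (volume.restrict (Icc 0 (2 * Real.pi))) ≤ B := by
  obtain ⟨-, hS⟩ := hf
  set S := ⨆ r ∈ Ioo (0 : ℝ) 1, ENNReal.ofReal (1 / (2 * Real.pi)) *
    ∫⁻ θ in Icc 0 (2 * Real.pi), ‖f (r * Complex.exp (θ * Complex.I))‖ₑ ^ 2
  have hpi := Real.pi_pos
  have hfin : (ENNReal.ofReal (2 * Real.pi) * S) ^ (1 / 2 : ℝ) ≠ ∞ :=
    ENNReal.rpow_ne_top_of_nonneg (by norm_num) (ENNReal.mul_ne_top ENNReal.ofReal_ne_top hS.ne)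
  refine ⟨((ENNReal.ofReal (2 * Real.pi) * S) ^ (1 / 2 : ℝ)).toNNReal, fun r hr => ?_⟩
  rw [ENNReal.coe_toNNReal hfin, eLpNorm_eq_lintegral_rpow_enorm_toReal (by norm_num) (by norm_num)]
  simp only [ENNReal.toReal_ofNat]
  gcongr
  calc _ = ENNReal.ofReal (2 * Real.pi) * (ENNReal.ofReal (1 / (2 * Real.pi)) *
        ∫⁻ θ in Icc 0 (2 * Real.pi), ‖f (r * Complex.exp (θ * Complex.I))‖ₑ ^ 2) := by
        rw [← mul_assoc, ← ENNReal.ofReal_mul (by positivity),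
          mul_one_div_cancel (by positivity), ENNReal.ofReal_one, one_mul]
        norm_cast
    _ ≤ _ := by
        gcongr
        exact le_iSup₂_of_le r hr le_rfl

variable {f : ℂ → ℂ} {F : Circle → ℂ}

/-- The boundary function of a Hardy function is square integrable. -/
lemma MemHardy.memLp_boundary (hf : MemHardy f) (hF : IsBoundaryFunction f F) :
    MemLp (fun θ : ℝ => F (Circle.exp θ)) 2 (volume.restrict (Icc 0 (2 * Real.pi))) := by
  obtain ⟨r, hr, hlim⟩ := exists_seq_radii
  obtain ⟨B, hB⟩ := hf.exists_eLpNorm_le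
  refine (tendsto_integral_of_eLpNorm_two_le
    (fun n => (hf.1.continuous_circle (hr n)).aestronglyMeasurable) (fun n => hB _ (hr n)) ?_).1
  filter_upwards [ae_restrict_of_ae hF] with θ hθ using hθ.comp hlim

lemma periodic_boundary (F : Circle → ℂ) :
    Function.Periodic (fun θ : ℝ => F (Circle.exp θ)) (2 * Real.pi) := fun θ => by
  simp [Circle.exp_add]

lemma MemHardy.integrableOn_boundary (hf : MemHardy f) (hF : IsBoundaryFunction f F) (a b : ℝ) :
    IntegrableOn (fun θ : ℝ => F (Circle.exp θ)) (Icc a b) := by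
  rcases lt_or_ge b a with hab | hab
  · simp [Icc_eq_empty_of_lt hab]
  rw [integrableOn_Icc_iff_integrableOn_Ioc, ← intervalIntegrable_iff_integrableOn_Ioc_of_le hab]
  refine (periodic_boundary F).intervalIntegrable₀ Real.two_pi_pos.ne' ?_ a b
  rw [intervalIntegrable_iff_integrableOn_Icc_of_le Real.two_pi_pos.le]
  exact (hf.memLp_boundary hF).integrable (by norm_num)

/-- Cauchy's formula for the derivative of a Hardy function in terms of its boundary function. -/
lemma MemHardy.integral_boundary_eq_deriv (hf : MemHardy f) (hF : IsBoundaryFunction f F) {z : ℂ}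
    (hz : z ∈ disc) :
    ∫ θ in Icc 0 (2 * Real.pi), deriv (circleMap 0 1) θ / (circleMap 0 1 θ - z) ^ 2 *
      F (Circle.exp θ) = 2 * Real.pi * Complex.I * deriv f z := by
  obtain ⟨r, hr, hlim⟩ := exists_seq_radii
  obtain ⟨B, hB⟩ := hf.exists_eLpNorm_le
  have hz1 := mem_disc.mp hz
  have hcauchy : ∀ n, ∫ θ in Icc 0 (2 * Real.pi),
      deriv (circleMap 0 1) θ / (circleMap 0 1 θ - z) ^ 2 * f (r n * Complex.exp (θ * Complex.I)) =
        2 * Real.pi * Complex.I * (r n * deriv f (r n * z)) := by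
    intro n
    have hrn := hr n
    have hd : DifferentiableOn ℂ (fun ζ => f (r n * ζ)) (Metric.ball 0 (1 / r n)) := by
      refine hf.1.comp (by fun_prop) fun ζ hζ => ?_
      rw [mem_ball_zero_iff, lt_div_iff₀ hrn.1] at hζ
      rw [mem_disc, norm_mul, Complex.norm_real, Real.norm_of_nonneg hrn.1.le]
      linarith
    have hsub : Metric.closedBall (0 : ℂ) 1 ⊆ Metric.ball 0 (1 / r n) :=
      Metric.closedBall_subset_ball (by rw [lt_div_iff₀ hrn.1]; linarith [hrn.2])
    have h := Complex.two_pi_I_inv_smul_circleIntegral_sub_sq_inv_smul_of_differentiable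
      Metric.isOpen_ball hsub hd (w₀ := z) hz
    rw [inv_smul_eq_iff₀ Complex.two_pi_I_ne_zero, circleIntegral_def_Icc, deriv_comp_mul_left] at h
    simp only [smul_eq_mul] at h
    rw [← h]
    refine setIntegral_congr_fun measurableSet_Icc fun θ _ => ?_
    simp only [circleMap, zero_add, Complex.ofReal_one, one_mul]
    ring
  have hker : ∀ θ : ℝ, ‖deriv (circleMap 0 1) θ / (circleMap 0 1 θ - z) ^ 2‖ ≤
      1 / (1 - ‖z‖) ^ 2 := by
    intro θ
    have h1 : 1 - ‖z‖ ≤ ‖circleMap 0 1 θ - z‖ := by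
      simpa using norm_sub_norm_le (circleMap 0 1 θ) z
    have : 0 < 1 - ‖z‖ := by linarith
    rw [norm_div, norm_pow]
    simp only [deriv_circleMap, norm_mul, norm_circleMap_zero, Complex.norm_I, abs_one, mul_one]
    gcongr
  have hne : ∀ θ, (circleMap 0 1 θ - z) ^ 2 ≠ 0 := by
    intro θ h
    have : circleMap 0 1 θ = z := by simpa [sub_eq_zero] using h
    rw [← this] at hz1
    simp at hz1
  have hkc : Continuous fun θ : ℝ => deriv (circleMap 0 1) θ / (circleMap 0 1 θ - z) ^ 2 := by
    simp only [deriv_circleMap]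
    fun_prop (disch := exact hne _)
  have h1 := (tendsto_integral_of_eLpNorm_two_le (μ := volume.restrict (Icc 0 (2 * Real.pi)))
    (g := fun n θ => deriv (circleMap 0 1) θ / (circleMap 0 1 θ - z) ^ 2 *
      f (r n * Complex.exp (θ * Complex.I)))
    (G := fun θ => deriv (circleMap 0 1) θ / (circleMap 0 1 θ - z) ^ 2 * F (Circle.exp θ))
    (B := (1 / (1 - ‖z‖) ^ 2).toNNReal * B)
    (fun n => (hkc.mul (hf.1.continuous_circle (hr n))).aestronglyMeasurable) ?_ ?_).2
  · refine tendsto_nhds_unique h1 ?_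
    simp only [hcauchy]
    have hr1 : Tendsto r atTop (𝓝 1) := hlim.mono_right nhdsWithin_le_nhds
    have hr2 : Tendsto (fun n => (r n : ℂ)) atTop (𝓝 1) := by
      exact_mod_cast (Complex.continuous_ofReal.tendsto 1).comp hr1
    have h2 : Tendsto (fun n => deriv f (r n * z)) atTop (𝓝 (deriv f z)) := by
      have hc : ContinuousAt (deriv f) z :=
        (hf.1.deriv.differentiableAt (isOpen_disc.mem_nhds hz)).continuousAt
      refine hc.tendsto.comp ?_
      simpa using hr2.mul_const z
    simpa using (hr2.mul h2).const_mul (2 * Real.pi * Complex.I : ℂ)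
  · intro n
    refine (eLpNorm_le_mul_eLpNorm_of_ae_le_mul (c := 1 / (1 - ‖z‖) ^ 2)
      (g := fun θ : ℝ => f (r n * Complex.exp (θ * Complex.I))) (Eventually.of_forall fun θ => ?_)
      2).trans ?_
    · rw [norm_mul]
      gcongr
      exact hker θ
    · rw [ENNReal.coe_mul]
      gcongr
      · exact le_rfl
      · exact hB _ (hr n)
  · filter_upwards [ae_restrict_of_ae hF] with θ hθ using (hθ.comp hlim).const_mul _

/-! ### Growth of the derivative of a Morrey function -/

/-- A bound for the mean oscillation in `L¹`, obtained from the Cauchy-Schwarz inequality. -/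
lemma exists_integral_sub_arcMean_le {lam : ℝ}
    (hint : ∀ a b, IntegrableOn (fun θ : ℝ => F (Circle.exp θ)) (Icc a b))
    (hosc : meanOscillation lam F < ∞) :
    ∃ M : ℝ, 0 ≤ M ∧ ∀ a b, IsArc a b →
      ∫ θ in Icc a b, ‖F (Circle.exp θ) - arcMean F a b‖ ≤
        M * arcLength a b ^ ((1 + lam) / 2) := by
  set N := meanOscillation lam F with hN
  refine ⟨2 * Real.pi * N.toReal, by positivity, fun a b hab => ?_⟩
  have hpi := Real.pi_pos
  have hlen := arcLength_pos hab
  have hba := sub_eq_arcLength a b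
  have hle : (ENNReal.ofReal (1 / arcLength a b ^ lam) * (ENNReal.ofReal (1 / (2 * Real.pi)) *
      ∫⁻ θ in Icc a b, ‖F (Circle.exp θ) - arcMean F a b‖ₑ ^ 2)) ^ (1 / 2 : ℝ) ≤ N :=
    le_iSup₂_of_le a b (le_iSup_of_le hab le_rfl)
  set h := arcLength a b
  set G : ℝ → ℂ := fun θ => F (Circle.exp θ) - arcMean F a b with hG
  have hGm : AEStronglyMeasurable G (volume.restrict (Icc a b)) :=
    (hint a b).aestronglyMeasurable.sub aestronglyMeasurable_const
  set X := ∫⁻ θ in Icc a b, ‖G θ‖ₑ ^ 2 with hX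
  have h2 : eLpNorm G 2 (volume.restrict (Icc a b)) = X ^ (1 / 2 : ℝ) := by
    rw [eLpNorm_eq_lintegral_rpow_enorm_toReal (by norm_num) (by norm_num)]
    simp only [ENNReal.toReal_ofNat, hX]
    norm_cast
  have hhl : 0 < h ^ lam := Real.rpow_pos_of_pos hlen _
  have hXN : X ^ (1 / 2 : ℝ) ≤ ENNReal.ofReal (2 * Real.pi * h ^ lam) ^ (1 / 2 : ℝ) * N := by
    calc X ^ (1 / 2 : ℝ) = (ENNReal.ofReal (2 * Real.pi * h ^ lam) *
          (ENNReal.ofReal (1 / h ^ lam) * (ENNReal.ofReal (1 / (2 * Real.pi)) * X))) ^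
            (1 / 2 : ℝ) := by
          rw [← mul_assoc, ← mul_assoc, ← ENNReal.ofReal_mul (by positivity),
            ← ENNReal.ofReal_mul (by positivity)]
          have : 2 * Real.pi * h ^ lam * (1 / h ^ lam) * (1 / (2 * Real.pi)) = 1 := by field_simp
          rw [this, ENNReal.ofReal_one, one_mul]
      _ ≤ _ := by
          rw [ENNReal.mul_rpow_of_nonneg _ _ (by norm_num)]
          gcongr
  have h1 : eLpNorm G 1 (volume.restrict (Icc a b)) ≤
      ENNReal.ofReal (2 * Real.pi * h ^ ((1 + lam) / 2)) * N := by
    calc eLpNorm G 1 (volume.restrict (Icc a b))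
        ≤ eLpNorm G 2 (volume.restrict (Icc a b)) * volume.restrict (Icc a b) univ ^
            (1 / (1 : ℝ≥0∞).toReal - 1 / (2 : ℝ≥0∞).toReal) :=
          eLpNorm_le_eLpNorm_mul_rpow_measure_univ (by norm_num) hGm
      _ ≤ ENNReal.ofReal (2 * Real.pi * h ^ lam) ^ (1 / 2 : ℝ) * N *
            ENNReal.ofReal (2 * Real.pi * h) ^ (1 / 2 : ℝ) := by
          have : 1 / (1 : ℝ≥0∞).toReal - 1 / (2 : ℝ≥0∞).toReal = (1 / 2 : ℝ) := by norm_num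
          rw [this, Measure.restrict_apply_univ, Real.volume_Icc, hba, h2]
          gcongr
      _ = _ := by
          rw [mul_right_comm, ← ENNReal.mul_rpow_of_nonneg _ _ (by norm_num),
            ← ENNReal.ofReal_mul (by positivity),
            ENNReal.ofReal_rpow_of_nonneg (by positivity) (by norm_num)]
          congr 2
          have : 2 * Real.pi * h ^ lam * (2 * Real.pi * h) =
              (2 * Real.pi) ^ 2 * h ^ (1 + lam) := by
            rw [add_comm, Real.rpow_add_one hlen.ne']; ring
          rw [this, Real.mul_rpow (by positivity) (by positivity), ← Real.sqrt_eq_rpow,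
            Real.sqrt_sq (by positivity), ← Real.rpow_mul hlen.le]
          ring_nf
  rw [integral_norm_eq_lintegral_enorm hGm, ← eLpNorm_one_eq_lintegral_enorm]
  refine (ENNReal.toReal_mono (ENNReal.mul_ne_top ENNReal.ofReal_ne_top hosc.ne) h1).trans
    (le_of_eq ?_)
  rw [ENNReal.toReal_mul, ENNReal.toReal_ofReal (by positivity)]
  ring

/-- The dyadic arc of normalized length `2⁻ᵏ` centred at `e^{it}`, as an interval of angles. -/
def dyadicArc (t : ℝ) (k : ℕ) : Set ℝ :=
  Icc (t - Real.pi * (1 / 2) ^ k) (t + Real.pi * (1 / 2) ^ k)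

lemma measurableSet_dyadicArc (t : ℝ) (k : ℕ) : MeasurableSet (dyadicArc t k) := measurableSet_Icc

lemma isCompact_dyadicArc (t : ℝ) (k : ℕ) : IsCompact (dyadicArc t k) := isCompact_Icc

lemma dyadicArc_succ_subset (t : ℝ) (k : ℕ) : dyadicArc t (k + 1) ⊆ dyadicArc t k := by
  have : 0 ≤ Real.pi * (1 / 2) ^ k := by have := Real.pi_pos; positivity
  refine Icc_subset_Icc ?_ ?_ <;> rw [pow_succ] <;> linarith

lemma dyadicArc_zero (t : ℝ) : dyadicArc t 0 = Icc (t - Real.pi) (t - Real.pi + 2 * Real.pi) := by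
  rw [dyadicArc]
  congr 1 <;> ring

/-- Integrals of periodic functions over a full period. -/
lemma integral_dyadicArc_zero {E : Type*} [NormedAddCommGroup E] [NormedSpace ℝ E] {u : ℝ → E}
    (hu : Function.Periodic u (2 * Real.pi)) (t : ℝ) :
    ∫ θ in dyadicArc t 0, u θ = ∫ θ in Icc 0 (2 * Real.pi), u θ := by
  have h := hu.intervalIntegral_add_eq (t - Real.pi) 0
  rw [zero_add, intervalIntegral.integral_of_le (by linarith [Real.pi_pos]),
    intervalIntegral.integral_of_le Real.two_pi_pos.le] at h
  rw [dyadicArc_zero, integral_Icc_eq_integral_Ioc, h, integral_Icc_eq_integral_Ioc]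

/-- The boundary function of a Morrey function satisfies Morrey's condition
`∫_I |F| ≲ |I|^{(1+λ)/2}` on dyadic arcs. Halving an arc halves the contribution of the mean value,
which is less than the factor `2^{-(1+λ)/2}`, and the rest is controlled by the oscillation. -/
lemma exists_integral_dyadicArc_le {lam : ℝ} (h1 : lam < 1)
    (hint : ∀ a b, IntegrableOn (fun θ : ℝ => F (Circle.exp θ)) (Icc a b))
    (hosc : meanOscillation lam F < ∞) :
    ∃ A : ℝ, 0 ≤ A ∧ ∀ t k, ∫ θ in dyadicArc t k, ‖F (Circle.exp θ)‖ ≤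
      A * ((1 / 2 : ℝ) ^ ((1 + lam) / 2)) ^ k := by
  obtain ⟨M, hM0, hM⟩ := exists_integral_sub_arcMean_le hint hosc
  set p : ℝ := (1 / 2 : ℝ) ^ ((1 + lam) / 2) with hp
  have hpi := Real.pi_pos
  have hp2 : 1 / 2 < p := by
    have := Real.rpow_lt_rpow_of_exponent_gt (x := 1 / 2) (by norm_num) (by norm_num)
      (by linarith : (1 + lam) / 2 < 1)
    rwa [Real.rpow_one] at this
  set m₀ := ∫ θ in Icc 0 (2 * Real.pi), ‖F (Circle.exp θ)‖ with hm₀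
  set A := max m₀ (M / (p - 1 / 2)) with hA
  have hA1 : M + A / 2 ≤ A * p := by
    have : M / (p - 1 / 2) ≤ A := le_max_right _ _
    rw [div_le_iff₀ (by linarith)] at this
    linarith
  refine ⟨A, le_max_of_le_left (integral_nonneg fun _ => norm_nonneg _), fun t k => ?_⟩
  induction k with
  | zero =>
    have hu : Function.Periodic (fun θ : ℝ => ‖F (Circle.exp θ)‖) (2 * Real.pi) :=
      (periodic_boundary F).comp norm
    rw [integral_dyadicArc_zero hu, pow_zero, mul_one]
    exact le_max_left _ _
  | succ k ih =>
    set a := t - Real.pi * (1 / 2) ^ k with ha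
    set b := t + Real.pi * (1 / 2) ^ k with hb
    have hk : (0 : ℝ) < (1 / 2) ^ k := by positivity
    have hk1 : (1 / 2 : ℝ) ^ k ≤ 1 := pow_le_one₀ (by norm_num) (by norm_num)
    have harc : IsArc a b := by constructor <;> nlinarith
    have hlen : arcLength a b = (1 / 2) ^ k := by
      rw [arcLength, ha, hb]; field_simp; ring
    have hba : b - a = 2 * Real.pi * (1 / 2) ^ k := by rw [ha, hb]; ring
    have hJ : dyadicArc t k = Icc a b := rfl
    have hosc_k := hM a b harc
    rw [hlen] at hosc_k
    have hpk : ((1 / 2 : ℝ) ^ k) ^ ((1 + lam) / 2) = p ^ k := by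
      rw [hp, ← Real.rpow_natCast, ← Real.rpow_natCast, ← Real.rpow_mul (by norm_num),
        ← Real.rpow_mul (by norm_num), mul_comm]
    rw [hpk] at hosc_k
    have hFk := hint a b
    have hsub : dyadicArc t (k + 1) ⊆ Icc a b := dyadicArc_succ_subset t k
    have hGk : IntegrableOn (fun θ => F (Circle.exp θ) - arcMean F a b) (Icc a b) :=
      hFk.sub (by simp)
    have hvol : (volume : Measure ℝ).real (dyadicArc t (k + 1)) = Real.pi * (1 / 2) ^ k := by
      have : 0 ≤ Real.pi * (1 / 2) ^ (k + 1) := by positivity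
      rw [dyadicArc, Real.volume_real_Icc_of_le (by linarith)]
      ring
    have hmean : Real.pi * (1 / 2) ^ k * ‖arcMean F a b‖ ≤ A * p ^ k / 2 := by
      rw [hJ] at ih
      have : ‖∫ θ in Icc a b, F (Circle.exp θ)‖ ≤ A * p ^ k :=
        (norm_integral_le_integral_norm _).trans ih
      rw [arcMean_eq, hba, norm_smul, norm_inv, Real.norm_of_nonneg (by positivity)]
      calc _ = ‖∫ θ in Icc a b, F (Circle.exp θ)‖ / 2 := by field_simp
        _ ≤ _ := by gcongr
    calc ∫ θ in dyadicArc t (k + 1), ‖F (Circle.exp θ)‖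
        ≤ ∫ θ in dyadicArc t (k + 1), (‖F (Circle.exp θ) - arcMean F a b‖ + ‖arcMean F a b‖) := by
          refine setIntegral_mono (hFk.mono_set hsub).norm
            ((hGk.mono_set hsub).norm.add (by simp [dyadicArc])) fun θ => ?_
          simpa using norm_add_le (F (Circle.exp θ) - arcMean F a b) (arcMean F a b)
      _ = (∫ θ in dyadicArc t (k + 1), ‖F (Circle.exp θ) - arcMean F a b‖) +
            Real.pi * (1 / 2) ^ k * ‖arcMean F a b‖ := by
          rw [integral_add (hGk.mono_set hsub).norm (by simp [dyadicArc]), setIntegral_const, hvol,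
            smul_eq_mul]
      _ ≤ M * p ^ k + A * p ^ k / 2 := by
          gcongr
          exact (setIntegral_mono_set hGk.norm (Eventually.of_forall fun _ => norm_nonneg _)
            hsub.eventuallyLE).trans hosc_k
      _ = (M + A / 2) * p ^ k := by ring
      _ ≤ A * p * p ^ k := by gcongr
      _ = A * p ^ (k + 1) := by ring

lemma one_sub_norm_le_norm_circleMap_sub (z : ℂ) (θ : ℝ) : 1 - ‖z‖ ≤ ‖circleMap 0 1 θ - z‖ := by
  simpa using norm_sub_norm_le (circleMap 0 1 θ) z

/-- Jordan's inequality bounds the distance from `e^{iθ}` to `z / |z|` from below, and the distance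
from `e^{iθ}` to `z` is at least half of that. -/
lemma abs_sub_arg_le_norm_circleMap_sub {z : ℂ} (hz : z ∈ disc) {θ : ℝ}
    (hθ : |θ - z.arg| ≤ Real.pi) : |θ - z.arg| ≤ Real.pi * ‖circleMap 0 1 θ - z‖ := by
  have hpi := Real.pi_pos
  have hz1 := mem_disc.mp hz
  set s := θ - z.arg with hs
  set e : ℂ := Complex.exp (z.arg * Complex.I) with he
  have hze : ‖e - z‖ ≤ ‖circleMap 0 1 θ - z‖ := by
    have h1 : e - z = ((1 - ‖z‖ : ℝ) : ℂ) * e := by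
      conv_lhs => rw [← Complex.norm_mul_exp_arg_mul_I z]
      push_cast
      ring
    rw [h1, norm_mul, Complex.norm_exp_ofReal_mul_I, mul_one, Complex.norm_real,
      Real.norm_of_nonneg (by linarith)]
    exact one_sub_norm_le_norm_circleMap_sub z θ
  have hchord : 2 / Real.pi * |s| ≤ ‖circleMap 0 1 θ - e‖ := by
    have h1 : circleMap 0 1 θ - e = e * (Complex.exp (Complex.I * (s : ℂ)) - 1) := by
      rw [mul_sub, he, ← Complex.exp_add, hs, circleMap]
      push_cast
      ring_nf
    have h2 : |Real.sin (s / 2)| = Real.sin (|s| / 2) := by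
      have hnonneg : 0 ≤ Real.sin (|s| / 2) :=
        Real.sin_nonneg_of_nonneg_of_le_pi (by positivity) (by linarith)
      rcases abs_cases s with ⟨h, -⟩ | ⟨h, -⟩ <;> rw [h] at hnonneg ⊢
      · exact abs_of_nonneg hnonneg
      · rw [neg_div, Real.sin_neg] at hnonneg ⊢
        exact abs_of_nonpos (by linarith)
    have h3 := Real.mul_le_sin (x := |s| / 2) (by positivity) (by linarith)
    rw [h1, norm_mul, Complex.norm_exp_ofReal_mul_I, one_mul,
      Complex.norm_exp_I_mul_ofReal_sub_one, norm_mul, Real.norm_eq_abs, Real.norm_eq_abs, h2,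
      abs_of_pos (two_pos (α := ℝ))]
    linarith
  have htri := norm_sub_le_norm_sub_add_norm_sub (circleMap 0 1 θ) z e
  rw [norm_sub_rev z e] at htri
  have : 2 / Real.pi * |s| ≤ 2 * ‖circleMap 0 1 θ - z‖ := by linarith
  rw [div_mul_eq_mul_div, div_le_iff₀ hpi] at this
  linarith

/-- Summation over dyadic arcs centred at `e^{it}` for a kernel `κ` which satisfies the bounds of
`|ζ - z|⁻²`, where `z = (1 - ρ) e^{it}`. -/
lemma exists_integral_kernel_mul_le {u κ : ℝ → ℝ} (hu : ∀ θ, 0 ≤ u θ) {t A q ρ : ℝ} (hA : 0 ≤ A)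
    (hq : 2 ≤ q) (hρ : 0 < ρ) (hρ1 : ρ ≤ 1) (hint : IntegrableOn u (dyadicArc t 0))
    (hκ : Continuous κ) (hκ0 : ∀ θ, 0 ≤ κ θ) (hκρ : ∀ θ, κ θ ≤ 1 / ρ ^ 2)
    (hκθ : ∀ θ ∈ dyadicArc t 0, κ θ * (θ - t) ^ 2 ≤ Real.pi ^ 2)
    (hm : ∀ k, ∫ θ in dyadicArc t k, u θ ≤ A * (q / 4) ^ k) :
    ∃ n : ℕ, ρ ≤ (1 / 2) ^ n ∧ ∫ θ in dyadicArc t 0, κ θ * u θ ≤ 8 * A * q ^ n := by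
  have hpi := Real.pi_pos
  have hsub : ∀ n, dyadicArc t n ⊆ dyadicArc t 0 := fun n =>
    antitone_nat_of_succ_le (dyadicArc_succ_subset t) (Nat.zero_le n)
  have hint_n : ∀ n, IntegrableOn u (dyadicArc t n) := fun n => hint.mono_set (hsub n)
  have hκu : ∀ n, IntegrableOn (fun θ => κ θ * u θ) (dyadicArc t n) := fun n =>
    (hint_n n).continuousOn_mul hκ.continuousOn (isCompact_dyadicArc t n)
  have hsum : ∀ n, ∫ θ in dyadicArc t 0, κ θ * u θ ≤
      4 * A * (q ^ n - 1) + ∫ θ in dyadicArc t n, κ θ * u θ := by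
    intro n
    induction n with
    | zero => simp
    | succ n ih =>
      have hdiff := setIntegral_sdiff (μ := volume) (f := fun θ => κ θ * u θ)
        (s := dyadicArc t n) (t := dyadicArc t (n + 1)) (measurableSet_dyadicArc t (n + 1)) (hκu n)
        (dyadicArc_succ_subset t n)
      have hshell : ∫ θ in dyadicArc t n \ dyadicArc t (n + 1), κ θ * u θ ≤ 4 * A * q ^ n := by
        calc ∫ θ in dyadicArc t n \ dyadicArc t (n + 1), κ θ * u θ
            ≤ ∫ θ in dyadicArc t n \ dyadicArc t (n + 1), 4 ^ (n + 1) * u θ := by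
              refine setIntegral_mono_on ((hκu n).mono_set sdiff_subset)
                (((hint_n n).mono_set sdiff_subset).const_mul _)
                ((measurableSet_dyadicArc t n).diff (measurableSet_dyadicArc t (n + 1))) fun θ hθ => ?_
              refine mul_le_mul_of_nonneg_right ?_ (hu θ)
              have h1 : Real.pi * (1 / 2) ^ (n + 1) ≤ |θ - t| := by
                by_contra! h
                rw [abs_lt] at h
                exact hθ.2 ⟨by linarith [h.1], by linarith [h.2]⟩
              have h2 : (Real.pi * (1 / 2) ^ (n + 1)) ^ 2 ≤ (θ - t) ^ 2 := by
                rw [← sq_abs (θ - t)]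
                gcongr
              have h3 : κ θ * (Real.pi * (1 / 2) ^ (n + 1)) ^ 2 ≤ Real.pi ^ 2 :=
                (mul_le_mul_of_nonneg_left h2 (hκ0 θ)).trans (hκθ θ (hsub n hθ.1))
              have h4 : (Real.pi * (1 / 2) ^ (n + 1)) ^ 2 = Real.pi ^ 2 / 4 ^ (n + 1) := by
                rw [mul_pow, ← pow_mul, mul_comm (n + 1) 2, pow_mul, div_pow, div_pow]
                norm_num
                rfl
              rw [h4, mul_div_assoc', div_le_iff₀ (by positivity), mul_comm] at h3
              exact le_of_mul_le_mul_left h3 (by positivity)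
          _ = 4 ^ (n + 1) * ∫ θ in dyadicArc t n \ dyadicArc t (n + 1), u θ :=
              integral_const_mul _ _
          _ ≤ 4 ^ (n + 1) * (A * (q / 4) ^ n) := by
              gcongr
              exact (setIntegral_mono_set (hint_n n) (Eventually.of_forall hu)
                sdiff_subset.eventuallyLE).trans (hm n)
          _ = 4 * A * q ^ n := by
              rw [div_pow, pow_succ]
              field_simp
      have hq' : 2 * q ^ n ≤ q ^ (n + 1) := by
        rw [pow_succ, mul_comm]
        gcongr
      nlinarith
  -- the summation stops at the arc of length comparable to `ρ`, on which `κ ≤ 1 / ρ²` is used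
  obtain ⟨n, hn1, hn2⟩ := exists_nat_pow_near_of_lt_one hρ hρ1
    (by norm_num : (0 : ℝ) < 1 / 2) (by norm_num)
  refine ⟨n, hn2, (hsum n).trans ?_⟩
  have hcore : ∫ θ in dyadicArc t n, κ θ * u θ ≤ 4 * A * q ^ n := by
    calc ∫ θ in dyadicArc t n, κ θ * u θ ≤ ∫ θ in dyadicArc t n, 1 / ρ ^ 2 * u θ :=
          setIntegral_mono (hκu n) ((hint_n n).const_mul _) fun θ =>
            mul_le_mul_of_nonneg_right (hκρ θ) (hu θ)
      _ = 1 / ρ ^ 2 * ∫ θ in dyadicArc t n, u θ := integral_const_mul _ _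
      _ ≤ 4 ^ (n + 1) * (A * (q / 4) ^ n) := by
          gcongr
          · exact integral_nonneg hu
          · rw [div_le_iff₀ (by positivity)]
            have h1 : ((1 / 2 : ℝ) ^ (n + 1)) ^ 2 ≤ ρ ^ 2 := by gcongr
            have h2 : (4 : ℝ) ^ (n + 1) * ((1 / 2 : ℝ) ^ (n + 1)) ^ 2 = 1 := by
              rw [← pow_mul, mul_comm (n + 1) 2, pow_mul, ← mul_pow]
              norm_num
            rw [← h2]
            gcongr
          · exact hm n
      _ = 4 * A * q ^ n := by
          rw [div_pow, pow_succ]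
          field_simp
  linarith

/-- The derivative of a Morrey function grows at most like `(1 - |z|²)^{-(3-λ)/2}`. The constant
depends on the function. -/
theorem MemMorrey.exists_norm_deriv_le {lam : ℝ} (h1 : lam < 1) (hf : MemMorrey lam f) :
    ∃ K : ℝ, ∀ z ∈ disc, (1 - ‖z‖ ^ 2) ^ ((3 - lam) / 2) * ‖deriv f z‖ ≤ K := by
  obtain ⟨hH, F, hF, hosc⟩ := hf
  have hint := hH.integrableOn_boundary hF
  obtain ⟨A, hA, hm⟩ := exists_integral_dyadicArc_le h1 hint hosc
  have hpi := Real.pi_pos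
  refine ⟨2 ^ ((3 - lam) / 2) * (8 * A), fun z hz => ?_⟩
  have hz1 := mem_disc.mp hz
  set ρ := 1 - ‖z‖ with hρ
  have hρ0 : 0 < ρ := by linarith
  have hρ1 : ρ ≤ 1 := by linarith [norm_nonneg z]
  set p : ℝ := (1 / 2 : ℝ) ^ ((1 + lam) / 2) with hp
  have hp2 : 1 / 2 ≤ p := by
    have := Real.rpow_le_rpow_of_exponent_ge (x := 1 / 2) (by norm_num) (by norm_num)
      (by linarith : (1 + lam) / 2 ≤ 1)
    rwa [Real.rpow_one] at this
  have hdist : ∀ θ, ρ ≤ ‖circleMap 0 1 θ - z‖ := one_sub_norm_le_norm_circleMap_sub z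
  have hdist0 : ∀ θ, ‖circleMap 0 1 θ - z‖ ^ 2 ≠ 0 := fun θ =>
    (pow_pos (hρ0.trans_le (hdist θ)) 2).ne'
  have hκ : ∀ θ ∈ dyadicArc z.arg 0,
      1 / ‖circleMap 0 1 θ - z‖ ^ 2 * (θ - z.arg) ^ 2 ≤ Real.pi ^ 2 := by
    intro θ hθ
    have habs : |θ - z.arg| ≤ Real.pi := by
      rw [dyadicArc, pow_zero, mul_one] at hθ
      exact abs_le.mpr ⟨by linarith [hθ.1], by linarith [hθ.2]⟩
    have h2 := abs_sub_arg_le_norm_circleMap_sub hz habs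
    rw [one_div_mul_eq_div, div_le_iff₀ (pow_pos (hρ0.trans_le (hdist θ)) 2), ← sq_abs (θ - z.arg),
      ← mul_pow]
    gcongr
  obtain ⟨n, hn, hle⟩ := exists_integral_kernel_mul_le
    (u := fun θ => ‖F (Circle.exp θ)‖) (κ := fun θ => 1 / ‖circleMap 0 1 θ - z‖ ^ 2)
    (t := z.arg) (q := 4 * p) (fun θ => norm_nonneg _) hA (by linarith) hρ0 hρ1
    (hint _ _).norm (by fun_prop (disch := exact hdist0 _)) (fun θ => by positivity)
    (fun θ => by have := hdist θ; gcongr) hκ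
    (fun k => by rw [mul_div_cancel_left₀ _ (by norm_num : (4 : ℝ) ≠ 0)]; exact hm _ k)
  have hcauchy := hH.integral_boundary_eq_deriv hF hz
  have hderiv : ‖deriv f z‖ ≤ 8 * A * (4 * p) ^ n := by
    have h2 : 2 * Real.pi * ‖deriv f z‖ ≤ 8 * A * (4 * p) ^ n := by
      have hper : Function.Periodic
          (fun θ => 1 / ‖circleMap 0 1 θ - z‖ ^ 2 * ‖F (Circle.exp θ)‖) (2 * Real.pi) := by
        intro θ
        have hF' := periodic_boundary F θ
        simp only at hF'
        simp only [periodic_circleMap 0 1 θ, hF']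
      calc 2 * Real.pi * ‖deriv f z‖ = ‖2 * Real.pi * Complex.I * deriv f z‖ := by
            simp [abs_of_pos hpi]
        _ ≤ ∫ θ in Icc 0 (2 * Real.pi), ‖deriv (circleMap 0 1) θ / (circleMap 0 1 θ - z) ^ 2 *
              F (Circle.exp θ)‖ := by
            rw [← hcauchy]
            exact norm_integral_le_integral_norm _
        _ = ∫ θ in Icc 0 (2 * Real.pi),
              1 / ‖circleMap 0 1 θ - z‖ ^ 2 * ‖F (Circle.exp θ)‖ := by
            simp [deriv_circleMap]
        _ ≤ 8 * A * (4 * p) ^ n := by rwa [← integral_dyadicArc_zero hper z.arg]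
    nlinarith [norm_nonneg (deriv f z), Real.pi_gt_three]
  have hs : 0 < (3 - lam) / 2 := by linarith
  have hδ : 0 ≤ 1 - ‖z‖ ^ 2 := by nlinarith [norm_nonneg z]
  have hδ2 : 1 - ‖z‖ ^ 2 ≤ 2 * (1 / 2) ^ n := by nlinarith [norm_nonneg z]
  have hpow : ((1 / 2 : ℝ) ^ n) ^ ((3 - lam) / 2) * (4 * p) ^ n = 1 := by
    have h4 : (4 : ℝ) = (1 / 2 : ℝ) ^ (-2 : ℝ) := by
      rw [Real.rpow_neg (by norm_num)]; norm_num
    rw [h4, hp, ← Real.rpow_add (by norm_num), ← Real.rpow_natCast, ← Real.rpow_natCast,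
      ← Real.rpow_mul (by norm_num), ← Real.rpow_mul (by norm_num),
      ← Real.rpow_add (by norm_num)]
    ring_nf
    exact Real.rpow_zero _
  calc (1 - ‖z‖ ^ 2) ^ ((3 - lam) / 2) * ‖deriv f z‖
      ≤ (2 * (1 / 2) ^ n) ^ ((3 - lam) / 2) * (8 * A * (4 * p) ^ n) := by gcongr
    _ = 2 ^ ((3 - lam) / 2) * (8 * A) * (((1 / 2 : ℝ) ^ n) ^ ((3 - lam) / 2) * (4 * p) ^ n) := by
        rw [Real.mul_rpow (by norm_num) (by positivity)]
        ring
    _ = _ := by rw [hpow, mul_one]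

/-! ### The norm of `I_g` -/

/-- A bound for the growth of `f'` turns into a bound for the Bloch norm of `I_g f`. -/
lemma blochNorm_opI_le {lam : ℝ} {g f : ℂ → ℂ} (hg : Holo g) (hf : Holo f) {K : ℝ≥0∞}
    (hK : ∀ z ∈ disc, ENNReal.ofReal ((1 - ‖z‖ ^ 2) ^ ((3 - lam) / 2) * ‖deriv f z‖) ≤ K) :
    blochNorm (opI g f) ≤ K * weightedNorm ((lam - 1) / 2) g := by
  rw [blochNorm_opI hg hf]
  refine iSup₂_le fun z hz => ?_
  have hδ : 0 < 1 - ‖z‖ ^ 2 := by nlinarith [norm_nonneg z, mem_disc.mp hz]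
  have hsplit : (1 - ‖z‖ ^ 2) * ‖deriv f z * g z‖ =
      (1 - ‖z‖ ^ 2) ^ ((3 - lam) / 2) * ‖deriv f z‖ *
        ((1 - ‖z‖ ^ 2) ^ ((lam - 1) / 2) * ‖g z‖) := by
    have : (1 - ‖z‖ ^ 2) ^ ((3 - lam) / 2) * (1 - ‖z‖ ^ 2) ^ ((lam - 1) / 2) = 1 - ‖z‖ ^ 2 := by
      rw [← Real.rpow_add hδ]
      ring_nf
      exact Real.rpow_one _
    rw [mul_mul_mul_comm, this, norm_mul]
  rw [hsplit, ENNReal.ofReal_mul (by positivity)]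
  exact mul_le_mul' (hK z hz) (le_iSup₂_of_le z hz le_rfl)

lemma blochNorm_opI_le_morreyNorm {lam : ℝ} (h0 : 0 < lam) (h1 : lam < 1) {g f : ℂ → ℂ}
    (hg : Holo g) (hf : Holo f) :
    blochNorm (opI g f) ≤ 20 * weightedNorm ((lam - 1) / 2) g * morreyNorm lam f := by
  rw [mul_right_comm]
  exact blochNorm_opI_le hg hf fun z hz => norm_deriv_le_morreyNorm h0 h1 hf hz

lemma memBloch_opI {lam : ℝ} (h1 : lam < 1) {g f : ℂ → ℂ}
    (hg : MemWeighted ((lam - 1) / 2) g) (hf : MemMorrey lam f) : MemBloch (opI g f) := by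
  obtain ⟨K, hK⟩ := hf.exists_norm_deriv_le h1
  exact ⟨holo_opI hg.1 hf.1.1, (blochNorm_opI_le hg.1 hf.1.1 fun z hz =>
    ENNReal.ofReal_le_ofReal (hK z hz)).trans_lt (ENNReal.mul_lt_top ENNReal.ofReal_lt_top hg.2)⟩

end MorreyBloch

theorem mainTheorem2 (lam : ℝ) (h0 : 0 < lam) (h1 : lam < 1) :
    (∀ g : ℂ → ℂ, MorreyBloch.Holo g →
      (MorreyBloch.IsBoundedI lam g ↔ MorreyBloch.MemWeighted ((lam - 1) / 2) g)) ∧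
    ∃ c C : ℝ≥0, 0 < c ∧ 0 < C ∧ ∀ g : ℂ → ℂ, MorreyBloch.Holo g →
      c * MorreyBloch.weightedNorm ((lam - 1) / 2) g ≤ MorreyBloch.opNormI lam g ∧
      MorreyBloch.opNormI lam g ≤ C * MorreyBloch.weightedNorm ((lam - 1) / 2) g := by
  open MorreyBloch in
  refine ⟨fun g hg => ⟨fun ⟨_, C, hC⟩ => ⟨hg, ?_⟩, fun hw => ⟨fun f hf => memBloch_opI h1 hw hf,
    20 * (weightedNorm ((lam - 1) / 2) g).toNNReal, fun f hf => ?_⟩⟩,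
    1 / 46, 20, by norm_num, by norm_num, fun g hg => ⟨?_, ?_⟩⟩
  · exact (weightedNorm_le_of_blochNorm_le h0 h1 hg hC).trans_lt
      (ENNReal.mul_lt_top ENNReal.coe_lt_top (by norm_num))
  · rw [ENNReal.coe_mul, ENNReal.coe_toNNReal hw.2.ne]
    exact blochNorm_opI_le_morreyNorm h0 h1 hg hf.1.1
  · refine le_sInf fun K hK => ?_
    have h := weightedNorm_le_of_blochNorm_le h0 h1 hg hK
    calc ((1 / 46 : ℝ≥0) : ℝ≥0∞) * weightedNorm ((lam - 1) / 2) g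
        ≤ ((1 / 46 : ℝ≥0) : ℝ≥0∞) * (K * ((46 : ℝ≥0) : ℝ≥0∞)) := by gcongr; exact_mod_cast h
      _ = K := by
        rw [mul_left_comm, ← ENNReal.coe_mul]
        norm_num
  · exact sInf_le fun f hf => blochNorm_opI_le_morreyNorm h0 h1 hg hf.1.1
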